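/- A circuit $C$ in negation normal form on a finite set $V$ of variables is a labelled directed acyclic graph without parallel edges and with a distinguished output gate $o$; gates of in-degree $0$ are labelled by a constant $0$, $1$ or a literal $v$, $\neg v$ with $v\in V$, all other gates by $\wedge$ or $\vee$. The inputs of a gate $g$ are the gates $h$ with an edge $(h,g)$; $\mathrm{var}(g)$ is the set of variables $v$ such that a gate labelled $v$ or $\neg v$ has a directed path to $g$; $|C|$ is the number of edges. $C$ is a *smooth DNNF* if distinct inputs of a $\wedge$-gate have disjoint sets $\mathrm{var}$, every input $h$ of a $\vee$-gate $g$ has $\mathrm{var}(h)=\mathrm{var}(g)$, and $\mathrm{var}(o)=V$. Let $\mathrm{conv}(C)\subseteq\mathbb R^V$ be the convex hull of the $0/1$ vectors of the assignments that satisfy $C$. For $y\in\mathbb R^{E(C)}$ and a gate $g$ let $y^{+}(g)=\sum_{f\text{ out of }g}y_f+[g=o]$ (one extra unit leaves at the output). The flow system of $C$, in variables $x\in\mathbb R^V$ and $y\in\mathbb R^{E(C)}$, consists of - $y_e\ge 0$ for every edge $e$; - $\sum_{e\text{ into }g}y_e=y^{+}(g)$ for every $\vee$-gate $g$; - $y_e=y^{+}(g)$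 for every $\wedge$-gate $g$ and every edge $e$ into $g$; - $y^{+}(g)=0$ for every gate $g$ labelled $0$; - $x_v=\sum_{g\text{ labelled }v}y^{+}(g)$ for every $v\in V$. A *certificate* of $C$ is a pair $(T,S)$ of a set $T$ of gates with $o\in T$ and a set $S$ of edges with both ends in $T$, such that $S$ contains exactly one edge into each $\vee$-gate of $T$, every edge into each $\wedge$-gate of $T$, and an edge out of each gate of $T$ other than $o$. A set $T$ of gates is a *gate certificate* if $o\in T$, every $\vee$-gate in $T$ has exactly one input in $T$, every $\wedge$-gate in $T$ has all its inputs in $T$, and every gate of $T$ other than $o$ is an input of some gate of $T$. Let $x^T\in\{0,1\}^V$ have $x^T_v=1$ if and only if some gate of $T$ is labelled by the literal $v$. **Theorem.** There are a constant $K$ and a program $P$ for a unit-cost random access machine (registers and arrays of natural numbers, whose only operations are constants, copying, successor, predecessor, indirect load and store, and comparisons) such that for every smooth DNNF $C$ there are matrices $A_C,G_C$ and a vector $b$ with the following properties. 1. $\mathrm{conv}(C)=\{x\in\mathbb R^V:\exists y\in\mathbb R^{E(C)},\ A_Cx+G_Cy\le b\}$. 2. $A_C$, $G_C$ and $b$ have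 at most $K\max(1,|C|)$ rows, and all their entries are in $\{-1,0,1\}$. 3. For all $x,y$, $A_Cx+G_Cy\le b$ holds if and only if $(x,y)$ satisfies the flow system of $C$. 4. If no gate of $C$ is labelled by a constant, then $(T,S)\mapsto(x^T,\mathbf 1_S)$ is a bijection from the certificates of $C$ to the integer points of $\{(x,y):A_Cx+G_Cy\le b\}$. If in addition no $\vee$-gate of $C$ has two distinct inputs $h,h'$ with a directed path from $h$ to $h'$, then $T\mapsto(x^T,y^T)$, where $y^T_e=1$ if both ends of $e$ are in $T$ and $y^T_e=0$ otherwise, is a bijection from the gate certificates of $C$ to the same integer points. 5. $P$, started on $C$ (given by its array of gate labels, its array of edges and its output gate), computes in at most $K\max(1,|C|)$ steps the vector $b$ and the lists of nonzero entries of $A_C$ and $G_C$. -/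

import Mathlib

open scoped Matrix

/-! ## NNF circuits -/

/-- Labels of gates: the constants `0` and `1`, the literals `x` (`lit x true`) and `¬x`
(`lit x false`), and the two connectives. -/
inductive GateLabel (V : Type*) where
  | const (b : Bool)
  | lit (x : V) (b : Bool)
  | conj
  | disj

/-- The labels that are allowed on gates of in-degree `0`. -/
def GateLabel.IsLeaf {V : Type*} : GateLabel V → Prop
  | const _ => True
  | lit _ _ => True
  | conj => False
  | disj => False

/-- A circuit in negation normal form, on the variables `V`, with gates `G` and edges `E`:
a labelled directed acyclic graph without parallel edges and with a distinguished output gate. -/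
structure NNF (V G E : Type*) where
  src : E → G
  dst : E → G
  simple : Function.Injective fun e => (src e, dst e)
  acyclic : ∀ g, ¬ Relation.TransGen (fun a b => ∃ e, src e = a ∧ dst e = b) g g
  label : G → GateLabel V
  leaf_iff : ∀ g, (label g).IsLeaf ↔ ∀ e, dst e ≠ g
  out : G

namespace NNF

variable {V G E : Type*}

/-- `h` is an input of `g`. -/
def Wire (C : NNF V G E) (h g : G) : Prop := ∃ e, C.src e = h ∧ C.dst e = g

/-- The variables mentioned below the gate `g`. -/
def vars (C : NNF V G E) (g : G) : Set V :=
  {x | ∃ h b, C.label h = .lit x b ∧ Relation.ReflTransGen C.Wire h g}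

/-- The gate `g` evaluates to true under the assignment `τ` (which matters only on `vars g`). -/
inductive Eval (C : NNF V G E) (τ : V → Bool) : G → Prop
  | one {g : G} : C.label g = .const true → Eval C τ g
  | lit {g : G} {x : V} {b : Bool} : C.label g = .lit x b → τ x = b → Eval C τ g
  | disj {g h : G} : C.label g = .disj → C.Wire h g → Eval C τ h → Eval C τ g
  | conj {g : G} : C.label g = .conj → (∀ h, C.Wire h g → Eval C τ h) → Eval C τ g

/-- The Boolean function computed by the circuit, as its set of satisfying assignments. -/
def models (C : NNF V G E) : Set (V → Bool) := {τ | C.Eval τ C.out}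

/-- DNNF: the inputs of every `∧`-gate mention pairwise disjoint sets of variables. -/
def IsDecomposable (C : NNF V G E) : Prop :=
  ∀ g h h', C.label g = .conj → C.Wire h g → C.Wire h' g → h ≠ h' →
    Disjoint (C.vars h) (C.vars h')

/-- Every input of a `∨`-gate mentions the same variables as the gate. -/
def IsSmooth (C : NNF V G E) : Prop :=
  ∀ g h, C.label g = .disj → C.Wire h g → C.vars g = C.vars h

/-- No gate is labelled by a constant. -/
def IsConstantFree (C : NNF V G E) : Prop := ∀ g b, C.label g ≠ .const b

/-- The `0/1` vector of an assignment. -/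
def point (τ : V → Bool) : V → ℝ := fun v => if τ v then 1 else 0

/-- The convex hull of the circuit. -/
def conv (C : NNF V G E) : Set (V → ℝ) := convexHull ℝ (point '' C.models)

/-! ### Certificates -/

/-- The set `T` of gates and the set `S` of edges form a certificate of the circuit: `S` contains
exactly one edge into every `∨`-gate of `T`, every edge into a `∧`-gate of `T`, and an edge out of
every gate of `T` other than the output. -/
structure IsCertificate (C : NNF V G E) (T : Set G) (S : Set E) : Prop where
  out_mem : C.out ∈ T
  ends : ∀ e ∈ S, C.src e ∈ T ∧ C.dst e ∈ T
  disj : ∀ g ∈ T, C.label g = .disj → ∃! e, C.dst e = g ∧ e ∈ S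
  conj : ∀ g ∈ T, C.label g = .conj → ∀ e, C.dst e = g → e ∈ S
  up : ∀ g ∈ T, g ≠ C.out → ∃ e ∈ S, C.src e = g

/-- The set `T` of gates is a certificate of the circuit: it contains the output, exactly one input
of each of its `∨`-gates, every input of each of its `∧`-gates, and each of its gates other than the
output is an input of one of its gates. -/
structure IsGateCertificate (C : NNF V G E) (T : Set G) : Prop where
  out_mem : C.out ∈ T
  disj : ∀ g ∈ T, C.label g = .disj → ∃! h, C.Wire h g ∧ h ∈ T
  conj : ∀ g ∈ T, C.label g = .conj → ∀ h, C.Wire h g → h ∈ T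
  up : ∀ g ∈ T, g ≠ C.out → ∃ h ∈ T, C.Wire g h

/-- No input of a `∨`-gate lies below another input of the same gate. (In `x ∨ (x ∨ ¬x)`, with one
gate labelled `x`, the gate `x` does lie below the second input of the output.) -/
def HasNoNestedInputs (C : NNF V G E) : Prop :=
  ∀ g h h', C.label g = .disj → C.Wire h g → C.Wire h' g → h ≠ h' →
    ¬ Relation.ReflTransGen C.Wire h h'

/-- The edges with both ends in `T`. -/
def induced (C : NNF V G E) (T : Set G) : Set E := {e | C.src e ∈ T ∧ C.dst e ∈ T}

open Classical in
/-- `x^T`: the coordinate `v` is `1` if a gate of `T` is labelled by the literal `v`, otherwise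
`0`. -/
noncomputable def certX (C : NNF V G E) (T : Set G) : V → ℝ :=
  fun v => if ∃ g ∈ T, C.label g = .lit v true then 1 else 0

open Classical in
/-- The incidence vector of a set of edges. -/
noncomputable def incidence (S : Set E) : E → ℝ := fun e => if e ∈ S then 1 else 0

/-! ### The flow system -/

open Classical in
/-- The flow that leaves `g`: the sum of `y` over the outgoing edges, plus one unit that leaves
the circuit through the output gate. -/
noncomputable def outflow [Fintype E] (C : NNF V G E) (y : E → ℝ) (g : G) : ℝ :=
  (∑ e with C.src e = g, y e) + if g = C.out then 1 else 0

open Classical in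
/-- The flow system in the variables `x` (one per variable of the circuit) and `y` (one per edge).
If the output is a `∨`-gate `o` without outgoing edges and there are no constants, then `disj`
reads `∑ (e into o), y e = 1` at `o` and `∑ (e into g), y e = ∑ (f out of g), y f` at every other
`∨`-gate `g`, `conj` reads `y e = ∑ (f out of g), y f` for every edge `e` into a `∧`-gate `g`, and
`proj` says that `x v` is the sum of `y` over the edges that leave an input labelled by `v`. -/
structure IsFlow [Fintype G] [Fintype E] (C : NNF V G E) (x : V → ℝ) (y : E → ℝ) : Prop where
  nonneg : ∀ e, 0 ≤ y e
  disj : ∀ g, C.label g = .disj → ∑ e with C.dst e = g, y e = C.outflow y g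
  conj : ∀ e, C.label (C.dst e) = .conj → y e = C.outflow y (C.dst e)
  zero : ∀ g, C.label g = .const false → C.outflow y g = 0
  proj : ∀ v, x v = ∑ g with C.label g = .lit v true, C.outflow y g

end NNF

/-- The integer points of the polyhedron `A x + B y ≤ b`. -/
def integerPoints {r k m : ℕ} (A : Matrix (Fin r) (Fin k) ℝ) (B : Matrix (Fin r) (Fin m) ℝ)
    (b : Fin r → ℝ) : Set ((Fin k → ℝ) × (Fin m → ℝ)) :=
  {p | A *ᵥ p.1 + B *ᵥ p.2 ≤ b ∧ (∀ v, ∃ z : ℤ, p.1 v = z) ∧ ∀ e, ∃ z : ℤ, p.2 e = z}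

/-! ## A random access machine -/

/-- Memory: registers `reg r`, and arrays `arr a` with cells `arr a i`. -/
structure RamMem where
  reg : ℕ → ℕ
  arr : ℕ → ℕ → ℕ

/-- Write `c` into the register `r`. -/
def RamMem.setReg (s : RamMem) (r c : ℕ) : RamMem :=
  { s with reg := Function.update s.reg r c }

/-- Write `c` into the cell `i` of the array `a`. -/
def RamMem.setArr (s : RamMem) (a i c : ℕ) : RamMem :=
  { s with arr := Function.update s.arr a (Function.update (s.arr a) i c) }

/-- Comparison of two registers. -/
inductive RamTest where
  | eq (r r' : ℕ)
  | lt (r r' : ℕ)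

def RamTest.Holds (s : RamMem) : RamTest → Prop
  | eq r r' => s.reg r = s.reg r'
  | lt r r' => s.reg r < s.reg r'

/-- Programs. There is no arithmetic beyond successor and predecessor: apart from the constants
of the program, `t` steps increase the largest number by at most `t`, so unit costs are realistic. -/
inductive RamProg where
  | const (r c : ℕ)
  | copy (r r' : ℕ)
  | succ (r : ℕ)
  | pred (r : ℕ)
  /-- `reg r := arr a [reg i]` -/
  | load (r a i : ℕ)
  /-- `arr a [reg i] := reg r` -/
  | store (a i r : ℕ)
  | skip
  | seq (p q : RamProg)
  | ite (b : RamTest) (p q : RamProg)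
  | loop (b : RamTest) (p : RamProg)

/-- `RamExec p s s' t`: the program `p`, started in the memory `s`, halts in the memory `s'` after
exactly `t` steps. Elementary instructions and tests cost one step each. -/
inductive RamExec : RamProg → RamMem → RamMem → ℕ → Prop
  | const (r c : ℕ) (s : RamMem) : RamExec (.const r c) s (s.setReg r c) 1
  | copy (r r' : ℕ) (s : RamMem) : RamExec (.copy r r') s (s.setReg r (s.reg r')) 1
  | succ (r : ℕ) (s : RamMem) : RamExec (.succ r) s (s.setReg r (s.reg r + 1)) 1
  | pred (r : ℕ) (s : RamMem) : RamExec (.pred r) s (s.setReg r (s.reg r - 1)) 1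
  | load (r a i : ℕ) (s : RamMem) :
      RamExec (.load r a i) s (s.setReg r (s.arr a (s.reg i))) 1
  | store (a i r : ℕ) (s : RamMem) :
      RamExec (.store a i r) s (s.setArr a (s.reg i) (s.reg r)) 1
  | skip (s : RamMem) : RamExec .skip s s 1
  | seq {p q : RamProg} {s s' s'' : RamMem} {t t' : ℕ} :
      RamExec p s s' t → RamExec q s' s'' t' → RamExec (.seq p q) s s'' (t + t')
  | iteTrue {b : RamTest} {p q : RamProg} {s s' : RamMem} {t : ℕ} :
      b.Holds s → RamExec p s s' t → RamExec (.ite b p q) s s' (t + 1)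
  | iteFalse {b : RamTest} {p q : RamProg} {s s' : RamMem} {t : ℕ} :
      ¬ b.Holds s → RamExec q s s' t → RamExec (.ite b p q) s s' (t + 1)
  | loopTrue {b : RamTest} {p : RamProg} {s s' s'' : RamMem} {t t' : ℕ} :
      b.Holds s → RamExec p s s' t → RamExec (.loop b p) s' s'' t' →
        RamExec (.loop b p) s s'' (t + t' + 1)
  | loopFalse {b : RamTest} {p : RamProg} {s : RamMem} :
      ¬ b.Holds s → RamExec (.loop b p) s s 1

/-! ## Input and output of the construction -/

/-- Numerical code of the kind of a gate. -/
def GateLabel.kind {V : Type*} : GateLabel V → ℕ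
  | const false => 0
  | const true => 1
  | lit _ false => 2
  | lit _ true => 3
  | conj => 4
  | disj => 5

/-- The index of the variable of a literal (`0` for the other labels). -/
def GateLabel.varIdx {k : ℕ} : GateLabel (Fin k) → ℕ
  | lit x _ => x
  | _ => 0

/-- The cells `0, …, n - 1` contain `f`, all others contain `0`. -/
def tabulate {n : ℕ} (f : Fin n → ℕ) : ℕ → ℕ := fun i => if h : i < n then f ⟨i, h⟩ else 0

/-- The memory that holds the circuit: registers `0, 1, 2, 3` contain the numbers of variables,
gates and edges and the output gate; array `0` contains the kinds of the gates, array `1` the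
variables of the literals, and arrays `2` and `3` the tails and heads of the edges.
Everything else is `0`. -/
def NNF.encode {k n m : ℕ} (C : NNF (Fin k) (Fin n) (Fin m)) : RamMem where
  reg
    | 0 => k
    | 1 => n
    | 2 => m
    | 3 => C.out
    | _ => 0
  arr
    | 0 => tabulate fun g => (C.label g).kind
    | 1 => tabulate fun g => (C.label g).varIdx
    | 2 => tabulate fun e => (C.src e : ℕ)
    | 3 => tabulate fun e => (C.dst e : ℕ)
    | _ => fun _ => 0

/-- Coefficients are coded by `0 ↦ 0`, `1 ↦ 1`, `2 ↦ -1` (codes above `2` are not used). -/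
def decodeCoeff : ℕ → ℝ
  | 0 => 0
  | 1 => 1
  | _ => -1

/-- The triples `(row t, col t, val t)`, `t < N`, list the nonzero entries of the matrix `M`, each
of them once. -/
def IsSparseList {r c : ℕ} (M : Matrix (Fin r) (Fin c) ℝ) (N : ℕ) (row col val : ℕ → ℕ) : Prop :=
  (∀ t < N, row t < r ∧ col t < c ∧ (val t = 1 ∨ val t = 2)) ∧
  (∀ t < N, ∀ t' < N, row t = row t' → col t = col t' → t = t') ∧
  ∀ i j a, a ≠ 0 →
    (M i j = a ↔ ∃ t < N, row t = i ∧ col t = j ∧ decodeCoeff (val t) = a)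

/-- The memory holds a sparse representation of the system `A x + B y ≤ b`: register `4` contains
the number of rows, registers `5` and `6` the numbers of nonzero entries of `A` and `B`, arrays
`4, 5, 6` list the entries of `A`, arrays `7, 8, 9` those of `B`, and array `10` contains `b`. -/
def RamMem.HoldsSystem {r k m : ℕ} (s : RamMem) (A : Matrix (Fin r) (Fin k) ℝ)
    (B : Matrix (Fin r) (Fin m) ℝ) (b : Fin r → ℝ) : Prop :=
  s.reg 4 = r ∧
  IsSparseList A (s.reg 5) (s.arr 4) (s.arr 5) (s.arr 6) ∧
  IsSparseList B (s.reg 6) (s.arr 7) (s.arr 8) (s.arr 9) ∧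
  ∀ i : Fin r, s.arr 10 i ≤ 2 ∧ b i = decodeCoeff (s.arr 10 i)

/-! A satisfying assignment selects a satisfied input at every satisfied ∨-gate. Sending one unit
from the output down the selected edges, and down all edges into satisfied ∧-gates, gives a flow.
The flow system relaxes these choices linearly, and the point is that nothing is lost.

Flow can be tracked one variable at a time: if an ∧-gate mentions `v`, exactly one of its inputs
does, and by smoothness every input of a ∨-gate that mentions `v` does. So one unit arrives at the
literals of each variable (`IsFlow.sum_outflow_literals`), which shows that every model is a
projected flow (`exists_isFlow_point`). For the converse, let `M g` be the maximum of a linear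
functional, restricted to the variables below `g`, over the assignments satisfying `g`. It acts as a
dual solution: the inflow of a gate weighted by `M` of the tails is at most the outflow times `M g`.
Summing over the gates with `sum_outflow_mul` bounds the functional on `x` by its value at a model
(`IsFlow.exists_model_ge`), and a separating hyperplane finishes the proof.

Integer points rest on `IsSuperflow.sum_outflow_le_one`. Without constants it bounds every outflow
by one, so an integral flow is 0/1 and its support is a certificate. Conversely, a certificate might
a priori have several edges out of one gate and hence only satisfies inequalities; the bound holds
for these superflows too and forces equality. Applied to two inputs of a ∨-gate, it shows that
without nested inputs the gates determine the edges (`IsCertificate.eq_induced`).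

For linear size, the outflow of an ∧-gate must not be repeated for each of its inputs. Each gate of
positive in-degree gets a leading edge that carries its equation; the other edges into an ∧-gate are
only equated with the leading one. Each edge then causes boundedly many coefficients. One list of
signed entries defines the matrix (`IsLead.forall_rowForm_le_iff`) and is also what the program
writes (`exists_ramExec_systemProg`). -/

namespace NNF

/-! ### Well-foundedness, variables below a gate, gluing of assignments -/

section Structure

variable {V G E : Type*} (C : NNF V G E)

theorem not_transGen_wire (g : G) : ¬ Relation.TransGen C.Wire g g := C.acyclic g

theorem wellFounded_wire [Finite G] : WellFounded C.Wire := by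
  have : IsTrans G (Relation.TransGen C.Wire) := ⟨fun _ _ _ => Relation.TransGen.trans⟩
  have : Std.Irrefl (Relation.TransGen C.Wire) := ⟨C.not_transGen_wire⟩
  exact Subrelation.wf (fun h => Relation.TransGen.single h)
    (Finite.wellFounded_of_trans_of_irrefl (Relation.TransGen C.Wire))

theorem wellFounded_flip_wire [Finite G] : WellFounded (fun a b => C.Wire b a) := by
  have : IsTrans G (fun a b => Relation.TransGen C.Wire b a) := ⟨fun _ _ _ h h' => h'.trans h⟩
  have : Std.Irrefl (fun a b => Relation.TransGen C.Wire b a) := ⟨C.not_transGen_wire⟩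
  exact Subrelation.wf (fun h => Relation.TransGen.single h)
    (Finite.wellFounded_of_trans_of_irrefl (fun a b => Relation.TransGen C.Wire b a))

theorem wire_src_dst (e : E) : C.Wire (C.src e) (C.dst e) := ⟨e, rfl, rfl⟩

theorem eq_of_src_eq_of_dst_eq {e e' : E} (h : C.src e = C.src e') (h' : C.dst e = C.dst e') :
    e = e' :=
  C.simple (Prod.ext h h')

theorem src_ne_dst (e : E) : C.src e ≠ C.dst e := fun h =>
  C.not_transGen_wire _ (Relation.TransGen.single (h ▸ C.wire_src_dst e))

theorem dst_ne_of_isLeaf {g : G} (h : (C.label g).IsLeaf) (e : E) : C.dst e ≠ g :=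
  (C.leaf_iff g).1 h e

theorem not_wire_of_isLeaf {g h : G} (hg : (C.label g).IsLeaf) : ¬ C.Wire h g :=
  fun ⟨e, _, he⟩ => C.dst_ne_of_isLeaf hg e he

theorem label_dst (e : E) : C.label (C.dst e) = .conj ∨ C.label (C.dst e) = .disj := by
  have h : ¬ (C.label (C.dst e)).IsLeaf := fun h => C.dst_ne_of_isLeaf h e rfl
  cases hl : C.label (C.dst e) <;> simp_all [GateLabel.IsLeaf]

theorem exists_dst_eq {g : G} (h : ¬ (C.label g).IsLeaf) : ∃ e, C.dst e = g := by
  rw [C.leaf_iff] at h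
  push Not at h
  exact h

theorem mem_vars_iff {g : G} {v : V} :
    v ∈ C.vars g ↔ (∃ b, C.label g = .lit v b) ∨ ∃ h, C.Wire h g ∧ v ∈ C.vars h := by
  constructor
  · rintro ⟨h, b, hl, hr⟩
    rcases Relation.ReflTransGen.cases_tail hr with rfl | ⟨c, hc, hw⟩
    · exact Or.inl ⟨b, hl⟩
    · exact Or.inr ⟨c, hw, h, b, hl, hc⟩
  · rintro (⟨b, hl⟩ | ⟨h, hw, l, b, hl, hr⟩)
    · exact ⟨g, b, hl, .refl⟩
    · exact ⟨l, b, hl, hr.tail hw⟩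

theorem vars_subset_of_wire {g h : G} (hw : C.Wire h g) : C.vars h ⊆ C.vars g :=
  fun _ hv => C.mem_vars_iff.2 (Or.inr ⟨h, hw, hv⟩)

theorem mem_vars_of_isLeaf {g : G} {v : V} (hg : (C.label g).IsLeaf) :
    v ∈ C.vars g ↔ ∃ b, C.label g = .lit v b := by
  rw [mem_vars_iff, or_iff_left]
  rintro ⟨h, hw, -⟩
  exact C.not_wire_of_isLeaf hg hw

theorem mem_vars_of_not_isLeaf {g : G} {v : V} (hg : ¬ (C.label g).IsLeaf) :
    v ∈ C.vars g ↔ ∃ e, C.dst e = g ∧ v ∈ C.vars (C.src e) := by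
  rw [mem_vars_iff, or_iff_right]
  · constructor
    · rintro ⟨_, ⟨e, rfl, he⟩, hv⟩
      exact ⟨e, he, hv⟩
    · rintro ⟨e, rfl, hv⟩
      exact ⟨_, C.wire_src_dst e, hv⟩
  · rintro ⟨b, hb⟩
    rw [hb] at hg
    exact hg trivial

/-- Descending along inputs ends at a leaf, which is a literal if there are no constants. This
supplies the variable to which the antichain bound is applied. -/
theorem vars_nonempty [Finite G] (hC : C.IsConstantFree) (g : G) : (C.vars g).Nonempty := by
  induction g using C.wellFounded_wire.induction with
  | _ g ih =>
    by_cases hg : (C.label g).IsLeaf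
    · cases hl : C.label g with
      | const b => exact absurd hl (hC g b)
      | lit x b => exact ⟨x, C.mem_vars_iff.2 (Or.inl ⟨b, hl⟩)⟩
      | conj => simp [hl, GateLabel.IsLeaf] at hg
      | disj => simp [hl, GateLabel.IsLeaf] at hg
    · obtain ⟨e, rfl⟩ := C.exists_dst_eq hg
      exact (ih _ (C.wire_src_dst e)).mono (C.vars_subset_of_wire (C.wire_src_dst e))

variable {C}

theorem Eval.congr {τ σ : V → Bool} {g : G} (h : C.Eval τ g) (hτ : ∀ v ∈ C.vars g, σ v = τ v) :
    C.Eval σ g := by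
  induction h with
  | one h => exact .one h
  | lit h h' => exact .lit h ((hτ _ (C.mem_vars_iff.2 (Or.inl ⟨_, h⟩))).trans h')
  | disj h hw _ ih => exact .disj h hw (ih fun v hv => hτ v (C.vars_subset_of_wire hw hv))
  | conj h _ ih =>
    exact .conj h fun a hw => ih a hw fun v hv => hτ v (C.vars_subset_of_wire hw hv)

/-- Absence of parallel edges turns uniqueness of the input into uniqueness of the edge. Sums over
the edges into an ∧-gate thereby collapse to one term. -/
theorem IsDecomposable.eq_of_mem_vars (hC : C.IsDecomposable) {e e' : E} {v : V}
    (h : C.dst e = C.dst e') (hl : C.label (C.dst e) = .conj) (hv : v ∈ C.vars (C.src e))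
    (hv' : v ∈ C.vars (C.src e')) : e = e' := by
  refine C.eq_of_src_eq_of_dst_eq ?_ h
  by_contra hne
  exact Set.disjoint_left.1
    (hC _ _ _ hl (C.wire_src_dst e) (h ▸ C.wire_src_dst e') hne) hv hv'

/-- Assignments that satisfy the inputs of a `∧`-gate can be glued. -/
theorem IsDecomposable.exists_glue (hC : C.IsDecomposable) {g : G} (hg : C.label g = .conj)
    (τ : G → V → Bool) (hτ : ∀ h, C.Wire h g → C.Eval (τ h) h) :
    ∃ σ, C.Eval σ g ∧ ∀ h, C.Wire h g → ∀ v ∈ C.vars h, σ v = τ h v := by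
  classical
  -- By decomposability only one input can mention `v`, so the choice is forced. The value `false`
  -- on the remaining variables is irrelevant.
  let σ : V → Bool := fun v => if h : ∃ h, C.Wire h g ∧ v ∈ C.vars h then τ h.choose v else false
  have key : ∀ h, C.Wire h g → ∀ v ∈ C.vars h, σ v = τ h v := by
    intro h hw v hv
    have hex : ∃ h, C.Wire h g ∧ v ∈ C.vars h := ⟨h, hw, hv⟩
    have : hex.choose = h := by
      by_contra hne
      exact Set.disjoint_left.1 (hC g _ _ hg hex.choose_spec.1 hw hne) hex.choose_spec.2 hv
    simp only [σ, dif_pos hex, this]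
  exact ⟨σ, .conj hg fun h hw => (hτ h hw).congr (key h hw), key⟩

end Structure

/-! ### Conservation of flow and the antichain bound -/

section Flow

variable {V G E : Type*} [Fintype E] {C : NNF V G E} {x : V → ℝ} {y : E → ℝ}

theorem outflow_nonneg (hy : ∀ e, 0 ≤ y e) (g : G) : 0 ≤ C.outflow y g := by
  classical
  unfold outflow
  have := Finset.sum_nonneg (s := Finset.univ.filter fun e => C.src e = g) fun e _ => hy e
  split_ifs <;> linarith

theorem le_outflow_src (hy : ∀ e, 0 ≤ y e) (e : E) : y e ≤ C.outflow y (C.src e) := by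
  classical
  unfold outflow
  have := Finset.single_le_sum (s := Finset.univ.filter fun a => C.src a = C.src e)
    (fun a _ => hy a) (Finset.mem_filter.2 ⟨Finset.mem_univ e, rfl⟩)
  split_ifs <;> linarith

theorem one_le_outflow_out (hy : ∀ e, 0 ≤ y e) : 1 ≤ C.outflow y C.out := by
  classical
  unfold outflow
  have := Finset.sum_nonneg (s := Finset.univ.filter fun e => C.src e = C.out) fun e _ => hy e
  rw [if_pos rfl]
  linarith

open Classical in
/-- The relaxation of the flow system in which gates may lose flow on the way down. -/
structure IsSuperflow (C : NNF V G E) (y : E → ℝ) : Prop where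
  nonneg : ∀ e, 0 ≤ y e
  disj : ∀ g, C.label g = .disj → ∑ e with C.dst e = g, y e ≤ C.outflow y g
  conj : ∀ e, C.label (C.dst e) = .conj → y e ≤ C.outflow y (C.dst e)

variable [Fintype G]

open Classical in
-- Double counting by tails. Regrouping the edge sum by heads turns a local comparison of weighted
-- inflow and outflow into a global one; the arguments below differ in the weight `w`.
theorem sum_outflow_mul (C : NNF V G E) (y : E → ℝ) (w : G → ℝ) :
    ∑ g, C.outflow y g * w g = ∑ e, y e * w (C.src e) + w C.out := by
  simp only [outflow, add_mul, Finset.sum_add_distrib, ite_mul, one_mul, zero_mul,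
    Finset.sum_ite_eq', Finset.mem_univ, if_true]
  congr 1
  rw [← Finset.sum_fiberwise Finset.univ C.src]
  refine Finset.sum_congr rfl fun g _ => ?_
  rw [Finset.sum_mul]
  refine Finset.sum_congr rfl fun e he => ?_
  rw [(Finset.mem_filter.1 he).2]

theorem IsFlow.isSuperflow (h : C.IsFlow x y) : C.IsSuperflow y :=
  ⟨h.nonneg, fun g hg => (h.disj g hg).le, fun e he => (h.conj e he).le⟩

open Classical in
/-- At most one unit leaves an antichain of gates that mention a common variable. -/
theorem IsSuperflow.sum_outflow_le_one (h : C.IsSuperflow y) (hC : C.IsDecomposable)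
    (A : Finset G) (v : V) (hv : ∀ a ∈ A, v ∈ C.vars a)
    (hA : ∀ a ∈ A, ∀ b ∈ A, ¬ Relation.TransGen C.Wire a b) :
    ∑ g ∈ A, C.outflow y g ≤ 1 := by
  -- The weight marks the gates that mention `v` and are not strictly below `A`. Weighted inflow
  -- never exceeds weighted outflow, and at a gate of `A` it vanishes because all inputs are
  -- unmarked. So all that leaves `A` is paid for by the unit at the output.
  let w : G → ℝ := fun g =>
    if v ∈ C.vars g ∧ ∀ a ∈ A, ¬ Relation.TransGen C.Wire g a then 1 else 0
  have w0 : ∀ g, 0 ≤ w g := fun g => by simp only [w]; split_ifs <;> norm_num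
  have w1 : ∀ g, w g ≤ 1 := fun g => by simp only [w]; split_ifs <;> norm_num
  have wA : ∀ a ∈ A, w a = 1 := fun a ha => if_pos ⟨hv a ha, hA a ha⟩
  have hin : ∀ g, ∑ e with C.dst e = g, y e * w (C.src e)
      ≤ C.outflow y g * w g - if g ∈ A then C.outflow y g else 0 := by
    intro g
    by_cases hgA : g ∈ A
    · rw [if_pos hgA, wA g hgA, mul_one, sub_self]
      refine (Finset.sum_eq_zero fun e he => ?_).le
      have hd := (Finset.mem_filter.1 he).2
      have : w (C.src e) = 0 :=
        if_neg fun hw => hw.2 g hgA (.single ⟨e, rfl, hd⟩)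
      rw [this, mul_zero]
    rw [if_neg hgA, sub_zero]
    by_cases hg : v ∈ C.vars g ∧ ∀ a ∈ A, ¬ Relation.TransGen C.Wire g a
    · have hwg : w g = 1 := if_pos hg
      rw [hwg, mul_one]
      by_cases hl : C.label g = .disj
      · refine le_trans (Finset.sum_le_sum fun e _ => ?_) (h.disj g hl)
        exact mul_le_of_le_one_right (h.nonneg e) (w1 _)
      -- At an ∧-gate at most one edge has a tail that mentions `v`; all other edges have weight
      -- zero.
      by_cases hex : ∃ e, C.dst e = g ∧ v ∈ C.vars (C.src e)
      · obtain ⟨e, rfl, he⟩ := hex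
        have hc := (C.label_dst e).resolve_right hl
        rw [Finset.sum_eq_single e]
        · exact (mul_le_of_le_one_right (h.nonneg e) (w1 _)).trans (h.conj e hc)
        · intro e' he' hne
          have hd := (Finset.mem_filter.1 he').2
          have : w (C.src e') = 0 :=
            if_neg fun hw => hne (hC.eq_of_mem_vars hd (hd ▸ hc) hw.1 he)
          rw [this, mul_zero]
        · exact fun hn => (hn (Finset.mem_filter.2 ⟨Finset.mem_univ _, rfl⟩)).elim
      · refine (Finset.sum_eq_zero fun e he => ?_).le.trans (outflow_nonneg h.nonneg g)
        have hd := (Finset.mem_filter.1 he).2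
        have : w (C.src e) = 0 := if_neg fun hw => hex ⟨e, hd, hw.1⟩
        rw [this, mul_zero]
    -- Marks propagate upwards: a gate with a marked input is itself marked, so an unmarked gate has
    -- weighted inflow zero.
    · have hwg : w g = 0 := if_neg hg
      rw [hwg, mul_zero]
      refine (Finset.sum_eq_zero fun e he => ?_).le
      have hd := (Finset.mem_filter.1 he).2
      have hw : C.Wire (C.src e) g := ⟨e, rfl, hd⟩
      have : w (C.src e) = 0 :=
        if_neg fun hw' => hg ⟨C.vars_subset_of_wire hw hw'.1,
          fun a ha ht => hw'.2 a ha (.head hw ht)⟩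
      rw [this, mul_zero]
  have h1 := C.sum_outflow_mul y w
  have h2 : ∑ e, y e * w (C.src e) = ∑ g, ∑ e with C.dst e = g, y e * w (C.src e) :=
    (Finset.sum_fiberwise Finset.univ C.dst _).symm
  have h3 := Finset.sum_le_sum fun g (_ : g ∈ Finset.univ) => hin g
  rw [Finset.sum_sub_distrib, Finset.sum_ite_mem, Finset.univ_inter] at h3
  have := w1 C.out
  linarith

/-- By acyclicity a single gate is an antichain, and without constants it mentions a variable. -/
theorem IsSuperflow.outflow_le_one (h : C.IsSuperflow y) (hC : C.IsDecomposable)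
    (hC' : C.IsConstantFree) (g : G) : C.outflow y g ≤ 1 := by
  obtain ⟨v, hv⟩ := C.vars_nonempty hC' g
  simpa using h.sum_outflow_le_one hC {g} v (by simpa using hv)
    (by simpa using C.not_transGen_wire g)

open Classical in
-- If an ∧-gate mentions `v`, the single edge from an input mentioning `v` carries the full outflow.
-- At a ∨-gate smoothness makes the weight the same for all inputs and the gate.
theorem IsFlow.sum_in_mul (h : C.IsFlow x y) (hC : C.IsDecomposable) (hS : C.IsSmooth) (v : V)
    {g : G} (hg : ¬ (C.label g).IsLeaf) :
    ∑ e with C.dst e = g, y e * (if v ∈ C.vars (C.src e) then 1 else 0)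
      = C.outflow y g * if v ∈ C.vars g then 1 else 0 := by
  obtain ⟨e₀, rfl⟩ := C.exists_dst_eq hg
  rcases C.label_dst e₀ with hl | hl
  · by_cases hv : v ∈ C.vars (C.dst e₀)
    · obtain ⟨e, hd, he⟩ := (C.mem_vars_of_not_isLeaf hg).1 hv
      rw [Finset.sum_eq_single e, if_pos he, if_pos hv, mul_one, mul_one, ← hd]
      · exact h.conj e (hd ▸ hl)
      · intro e' he' hne
        have hd' := (Finset.mem_filter.1 he').2
        rw [if_neg, mul_zero]
        exact fun hw => hne (hC.eq_of_mem_vars (hd'.trans hd.symm) (hd' ▸ hl) hw he)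
      · exact fun hn => (hn (Finset.mem_filter.2 ⟨Finset.mem_univ _, hd⟩)).elim
    · rw [if_neg hv, mul_zero]
      refine Finset.sum_eq_zero fun e he => ?_
      rw [if_neg, mul_zero]
      exact fun hw => hv (C.vars_subset_of_wire ⟨e, rfl, (Finset.mem_filter.1 he).2⟩ hw)
  · rw [← h.disj _ hl, Finset.sum_mul]
    refine Finset.sum_congr rfl fun e he => ?_
    rw [hS _ _ hl ⟨e, rfl, (Finset.mem_filter.1 he).2⟩]

open Classical in
/-- One unit of flow arrives at the literals of each variable. -/
theorem IsFlow.sum_outflow_literals (h : C.IsFlow x y) (hC : C.IsDecomposable) (hS : C.IsSmooth)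
    {v : V} (hv : v ∈ C.vars C.out) :
    ∑ g with ∃ b, C.label g = .lit v b, C.outflow y g = 1 := by
  have h1 := C.sum_outflow_mul y fun g => if v ∈ C.vars g then 1 else 0
  have h2 : ∑ e, y e * (if v ∈ C.vars (C.src e) then (1 : ℝ) else 0)
      = ∑ g, ∑ e with C.dst e = g, y e * (if v ∈ C.vars (C.src e) then (1 : ℝ) else 0) :=
    (Finset.sum_fiberwise Finset.univ C.dst _).symm
  rw [if_pos hv, h2] at h1
  rw [Finset.sum_filter]
  -- Outflow minus inflow, both weighted by `v`, vanishes at inner gates by conservation. Leaves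
  -- have no inflow, so only the literals of `v` survive.
  have h3 : ∑ g, (if ∃ b, C.label g = .lit v b then C.outflow y g else 0)
      = ∑ g, (C.outflow y g * (if v ∈ C.vars g then (1 : ℝ) else 0)
        - ∑ e with C.dst e = g, y e * (if v ∈ C.vars (C.src e) then (1 : ℝ) else 0)) := by
    refine Finset.sum_congr rfl fun g _ => ?_
    by_cases hg : (C.label g).IsLeaf
    · have : (Finset.univ.filter fun e => C.dst e = g) = ∅ :=
        Finset.filter_eq_empty_iff.2 fun e _ => C.dst_ne_of_isLeaf hg e
      rw [this, Finset.sum_empty, sub_zero]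
      simp only [C.mem_vars_of_isLeaf hg, mul_ite, mul_one, mul_zero]
    · rw [h.sum_in_mul hC hS v hg, sub_self, if_neg]
      rintro ⟨b, hb⟩
      rw [hb] at hg
      exact hg trivial
  rw [h3, Finset.sum_sub_distrib]
  linarith

open Classical in
theorem IsFlow.sum_outflow_pos_add_neg (h : C.IsFlow x y) (hC : C.IsDecomposable)
    (hS : C.IsSmooth) {v : V} (hv : v ∈ C.vars C.out) :
    x v + ∑ g with C.label g = .lit v false, C.outflow y g = 1 := by
  rw [h.proj, ← h.sum_outflow_literals hC hS hv, ← Finset.sum_union]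
  · congr 1
    ext g
    simp [or_comm]
  · rw [Finset.disjoint_filter]
    intro g _ hg hg'
    rw [hg] at hg'
    cases hg'

end Flow

end NNF

namespace NNF

/-! ### Certificates as integral flows -/

section Certificates

variable {V G E : Type*} {C : NNF V G E} {T : Set G} {S : Set E}

theorem incidence_of_mem {e : E} (h : e ∈ S) : incidence S e = 1 := if_pos h

theorem incidence_of_notMem {e : E} (h : e ∉ S) : incidence S e = 0 := if_neg h

theorem incidence_nonneg (S : Set E) (e : E) : 0 ≤ incidence S e := by
  unfold incidence
  split_ifs <;> norm_num

theorem incidence_injective : Function.Injective (incidence : Set E → E → ℝ) := by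
  intro S S' h
  ext e
  have := congrFun h e
  unfold incidence at this
  split_ifs at this <;> simp_all

theorem eq_zero_or_one_of_isInt {a : ℝ} (h : ∃ z : ℤ, a = z) (h0 : 0 ≤ a) (h1 : a ≤ 1) :
    a = 0 ∨ a = 1 := by
  obtain ⟨z, rfl⟩ := h
  have h0 : 0 ≤ z := by exact_mod_cast h0
  have h1 : z ≤ 1 := by exact_mod_cast h1
  have : z = 0 ∨ z = 1 := by omega
  rcases this with rfl | rfl <;> simp

theorem isInt_sum {ι : Type*} (s : Finset ι) (f : ι → ℝ) (hf : ∀ i, ∃ z : ℤ, f i = z) :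
    ∃ z : ℤ, ∑ i ∈ s, f i = z := by
  choose z hz using hf
  exact ⟨∑ i ∈ s, z i, by push_cast; exact Finset.sum_congr rfl fun i _ => hz i⟩

theorem IsCertificate.incidence_eq_of_conj (h : C.IsCertificate T S) {e : E}
    (he : C.label (C.dst e) = .conj) : incidence S e = incidence T (C.dst e) := by
  by_cases hT : C.dst e ∈ T
  · rw [incidence_of_mem hT, incidence_of_mem (h.conj _ hT he e rfl)]
  · rw [incidence_of_notMem hT, incidence_of_notMem fun hS => hT (h.ends e hS).2]

/-- The edges determine the gates; this gives injectivity in `bijOn_certificates`. -/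
theorem IsCertificate.eq_gates (h : C.IsCertificate T S) :
    T = insert C.out (C.src '' S) := by
  ext g
  constructor
  · intro hg
    by_cases ho : g = C.out
    · exact Or.inl ho
    · obtain ⟨e, he, rfl⟩ := h.up g hg ho
      exact Or.inr ⟨e, he, rfl⟩
  · rintro (rfl | ⟨e, he, rfl⟩)
    · exact h.out_mem
    · exact (h.ends e he).1

theorem IsGateCertificate.isCertificate (h : C.IsGateCertificate T) :
    C.IsCertificate T (C.induced T) where
  out_mem := h.out_mem
  ends _ he := he
  disj g hg hl := by
    obtain ⟨a, ⟨⟨e, rfl, hd⟩, ha⟩, hu⟩ := h.disj g hg hl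
    refine ⟨e, ⟨hd, ha, hd ▸ hg⟩, ?_⟩
    rintro e' ⟨hd', hs', -⟩
    exact C.eq_of_src_eq_of_dst_eq (hu _ ⟨⟨e', rfl, hd'⟩, hs'⟩) (hd'.trans hd.symm)
  conj g hg hl e he := ⟨h.conj g hg hl _ ⟨e, rfl, he⟩, by rw [he]; exact hg⟩
  up g hg ho := by
    obtain ⟨a, ha, e, rfl, rfl⟩ := h.up g hg ho
    exact ⟨e, ⟨hg, ha⟩, rfl⟩

theorem IsCertificate.isGateCertificate (h : C.IsCertificate T (C.induced T)) :
    C.IsGateCertificate T where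
  out_mem := h.out_mem
  disj g hg hl := by
    obtain ⟨e, ⟨hd, he⟩, hu⟩ := h.disj g hg hl
    refine ⟨C.src e, ⟨⟨e, rfl, hd⟩, he.1⟩, ?_⟩
    rintro _ ⟨⟨e', rfl, hd'⟩, hT⟩
    rw [hu e' ⟨hd', hT, hd' ▸ hg⟩]
  conj g hg hl a := by
    rintro ⟨e, rfl, hd⟩
    exact (h.conj g hg hl e hd).1
  up g hg ho := by
    obtain ⟨e, he, rfl⟩ := h.up g hg ho
    exact ⟨C.dst e, he.2, C.wire_src_dst e⟩

variable [Fintype E]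

theorem isInt_outflow {y : E → ℝ} (hy : ∀ e, ∃ z : ℤ, y e = z) (g : G) :
    ∃ z : ℤ, C.outflow y g = z := by
  classical
  obtain ⟨z, hz⟩ := isInt_sum (Finset.univ.filter fun e => C.src e = g) y hy
  refine ⟨z + if g = C.out then 1 else 0, ?_⟩
  unfold outflow
  push_cast
  rw [← hz]

/-- Only an inequality at this stage, since nothing in the definition forbids several edges of `S`
out of one gate. -/
theorem IsCertificate.indicator_le_outflow (h : C.IsCertificate T S) (g : G) :
    incidence T g ≤ C.outflow (incidence S) g := by
  by_cases hg : g ∈ T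
  · rw [incidence_of_mem hg]
    by_cases ho : g = C.out
    · exact ho ▸ one_le_outflow_out (incidence_nonneg S)
    · obtain ⟨e, he, rfl⟩ := h.up g hg ho
      exact (incidence_of_mem he).symm.le.trans (le_outflow_src (incidence_nonneg S) e)
  · rw [incidence_of_notMem hg]
    exact outflow_nonneg (incidence_nonneg S) g

open Classical in
theorem IsCertificate.sum_in (h : C.IsCertificate T S) {g : G} (hg : C.label g = .disj) :
    ∑ e with C.dst e = g, incidence S e = incidence T g := by
  by_cases hT : g ∈ T
  · obtain ⟨e, ⟨hd, he⟩, hu⟩ := h.disj g hT hg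
    rw [incidence_of_mem hT, Finset.sum_eq_single e, incidence_of_mem he]
    · intro e' he' hne
      exact incidence_of_notMem fun hS => hne (hu e' ⟨(Finset.mem_filter.1 he').2, hS⟩)
    · exact fun hn => (hn (Finset.mem_filter.2 ⟨Finset.mem_univ _, hd⟩)).elim
  · rw [incidence_of_notMem hT]
    refine Finset.sum_eq_zero fun e he => incidence_of_notMem fun hS => hT ?_
    exact (Finset.mem_filter.1 he).2 ▸ (h.ends e hS).2

theorem IsCertificate.isSuperflow (h : C.IsCertificate T S) : C.IsSuperflow (incidence S) where
  nonneg := incidence_nonneg S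
  disj g hg := (h.sum_in hg).le.trans (h.indicator_le_outflow g)
  conj _ he := (h.incidence_eq_of_conj he).le.trans (h.indicator_le_outflow _)

variable [Fintype G]

/-- A certificate is a superflow, so at most one unit leaves each gate. This excludes a second
outgoing edge in `S`, and any outgoing edge at the output. -/
theorem IsCertificate.outflow_eq (h : C.IsCertificate T S) (hC : C.IsDecomposable)
    (hC' : C.IsConstantFree) (g : G) : C.outflow (incidence S) g = incidence T g := by
  refine le_antisymm ?_ (h.indicator_le_outflow g)
  by_cases hg : g ∈ T
  · rw [incidence_of_mem hg]
    exact h.isSuperflow.outflow_le_one hC hC' g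
  · rw [incidence_of_notMem hg]
    classical
    have ho : g ≠ C.out := fun ho => hg (ho ▸ h.out_mem)
    unfold outflow
    rw [if_neg ho, add_zero]
    refine (Finset.sum_eq_zero fun e he => incidence_of_notMem fun hS => hg ?_).le
    exact (Finset.mem_filter.1 he).2 ▸ (h.ends e hS).1

open Classical in
-- Leaves have no inputs, so the gates labelled by one literal form an antichain. The bound
-- reconciles the sum in the projection equation with the 0/1 definition of `certX`.
theorem IsSuperflow.sum_outflow_pos_le_one {y : E → ℝ} (h : C.IsSuperflow y)
    (hC : C.IsDecomposable) (v : V) :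
    ∑ g with C.label g = .lit v true, C.outflow y g ≤ 1 := by
  refine h.sum_outflow_le_one hC _ v (fun a ha => ?_) fun a _ b hb hab => ?_
  · exact C.mem_vars_iff.2 (Or.inl ⟨true, (Finset.mem_filter.1 ha).2⟩)
  · obtain ⟨c, -, hc⟩ := Relation.TransGen.tail'_iff.1 hab
    have hl := (Finset.mem_filter.1 hb).2
    exact C.not_wire_of_isLeaf (hl ▸ trivial) hc

open Classical in
theorem IsSuperflow.certX_eq {y : E → ℝ} (h : C.IsSuperflow y) (hC : C.IsDecomposable)
    (hT : ∀ g, C.outflow y g = incidence T g) (v : V) :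
    C.certX T v = ∑ g with C.label g = .lit v true, C.outflow y g := by
  have h1 := h.sum_outflow_pos_le_one hC v
  unfold certX
  split_ifs with hex
  · obtain ⟨g, hg, hl⟩ := hex
    refine le_antisymm ?_ h1
    rw [← incidence_of_mem hg, ← hT g]
    exact Finset.single_le_sum (f := fun g => C.outflow y g)
      (fun a _ => outflow_nonneg h.nonneg a)
      (Finset.mem_filter.2 ⟨Finset.mem_univ g, hl⟩)
  · symm
    refine Finset.sum_eq_zero fun g hg => ?_
    rw [hT g]
    exact incidence_of_notMem fun hg' => hex ⟨g, hg', (Finset.mem_filter.1 hg).2⟩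

theorem IsCertificate.isFlow (h : C.IsCertificate T S) (hC : C.IsDecomposable)
    (hC' : C.IsConstantFree) : C.IsFlow (C.certX T) (incidence S) where
  nonneg := incidence_nonneg S
  disj g hg := (h.sum_in hg).trans (h.outflow_eq hC hC' g).symm
  conj _ he := (h.incidence_eq_of_conj he).trans (h.outflow_eq hC hC' _).symm
  zero g hg := absurd hg (hC' g false)
  proj v := h.isSuperflow.certX_eq hC (h.outflow_eq hC hC') v

/-- Integral flows come from certificates. -/
theorem IsFlow.exists_isCertificate {x : V → ℝ} {y : E → ℝ} (h : C.IsFlow x y)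
    (hC : C.IsDecomposable) (hC' : C.IsConstantFree) (hy : ∀ e, ∃ z : ℤ, y e = z) :
    ∃ T S, C.IsCertificate T S ∧ C.certX T = x ∧ incidence S = y := by
  classical
  have hs := h.isSuperflow
  have hout : ∀ g, C.outflow y g = 0 ∨ C.outflow y g = 1 := fun g =>
    eq_zero_or_one_of_isInt (isInt_outflow hy g) (outflow_nonneg h.nonneg g)
      (hs.outflow_le_one hC hC' g)
  have hy01 : ∀ e, y e = 0 ∨ y e = 1 := fun e =>
    eq_zero_or_one_of_isInt (hy e) (h.nonneg e)
      ((le_outflow_src h.nonneg e).trans (hs.outflow_le_one hC hC' _))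
  have of_le : ∀ g, 1 ≤ C.outflow y g → C.outflow y g = 1 := fun g hg => by
    rcases hout g with h0 | h1
    · linarith
    · exact h1
  have hS : incidence {e | y e = 1} = y := by
    funext e
    by_cases he : y e = 1
    · rw [incidence_of_mem (by exact he), he]
    · rw [incidence_of_notMem (by exact he), (hy01 e).resolve_right he]
  have hT : ∀ g, C.outflow y g = incidence {g | C.outflow y g = 1} g := fun g => by
    by_cases hg : C.outflow y g = 1
    · rw [incidence_of_mem (by exact hg), hg]
    · rw [incidence_of_notMem (by exact hg), (hout g).resolve_right hg]
  -- Outflows and edge values are integers between 0 and 1, so the support of the flow is the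
  -- candidate.
  refine ⟨{g | C.outflow y g = 1}, {e | y e = 1}, ?_, ?_, hS⟩
  · refine ⟨of_le _ (one_le_outflow_out h.nonneg), fun e he => ⟨of_le _ ?_, of_le _ ?_⟩,
      fun g hg hl => ?_, fun g hg hl e he => ?_, fun g hg ho => ?_⟩
    · exact he.symm.le.trans (le_outflow_src h.nonneg e)
    · have he : y e = 1 := he
      rcases C.label_dst e with hl | hl
      · rw [← h.conj e hl, he]
      · rw [← h.disj _ hl, ← he]
        exact Finset.single_le_sum (fun a _ => h.nonneg a)
          (Finset.mem_filter.2 ⟨Finset.mem_univ e, rfl⟩)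
    · have hsum := (h.disj g hl).trans hg
      have hex : ∃ e, C.dst e = g ∧ y e = 1 := by
        by_contra hne
        push Not at hne
        rw [Finset.sum_eq_zero] at hsum
        · norm_num at hsum
        · exact fun e he => (hy01 e).resolve_right (hne e (Finset.mem_filter.1 he).2)
      obtain ⟨e, hd, he⟩ := hex
      refine ⟨e, ⟨hd, he⟩, ?_⟩
      rintro e' ⟨hd', he'⟩
      by_contra hne
      have he' : y e' = 1 := he'
      have := Finset.sum_le_sum_of_subset_of_nonneg
        (s := {e', e}) (t := Finset.univ.filter fun e => C.dst e = g) (f := y)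
        (by intro a ha
            rcases Finset.mem_insert.1 ha with rfl | ha
            · exact Finset.mem_filter.2 ⟨Finset.mem_univ _, hd'⟩
            · rw [Finset.mem_singleton.1 ha]
              exact Finset.mem_filter.2 ⟨Finset.mem_univ _, hd⟩)
        fun a _ _ => h.nonneg a
      rw [Finset.sum_pair hne, hsum, he, he'] at this
      norm_num at this
    · subst he
      exact (h.conj e hl).trans hg
    · by_contra hne
      push Not at hne
      have hg : C.outflow y g = 1 := hg
      unfold outflow at hg
      rw [if_neg ho, add_zero, Finset.sum_eq_zero] at hg
      · norm_num at hg
      · exact fun e he => (hy01 e).resolve_right fun h1 => hne e h1 (Finset.mem_filter.1 he).2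
  · funext v
    rw [hs.certX_eq hC hT, h.proj]

theorem bijOn_certificates (hC : C.IsDecomposable) (hC' : C.IsConstantFree) :
    Set.BijOn (fun p : Set G × Set E => (C.certX p.1, incidence p.2))
      {p | C.IsCertificate p.1 p.2}
      {p | C.IsFlow p.1 p.2 ∧ (∀ v, ∃ z : ℤ, p.1 v = z) ∧ ∀ e, ∃ z : ℤ, p.2 e = z} := by
  classical
  refine ⟨fun p hp => ⟨IsCertificate.isFlow hp hC hC', fun v => ?_, fun e => ?_⟩,
    fun p hp q hq hpq => ?_, fun p hp => ?_⟩
  · by_cases h : ∃ g ∈ p.1, C.label g = .lit v true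
    · exact ⟨1, by simp only [certX, if_pos h, Int.cast_one]⟩
    · exact ⟨0, by simp only [certX, if_neg h, Int.cast_zero]⟩
  · by_cases h : e ∈ p.2
    · exact ⟨1, by simp only [incidence, if_pos h, Int.cast_one]⟩
    · exact ⟨0, by simp only [incidence, if_neg h, Int.cast_zero]⟩
  · have h2 : p.2 = q.2 := incidence_injective (Prod.ext_iff.1 hpq).2
    exact Prod.ext ((IsCertificate.eq_gates hp).trans
      ((congrArg (fun S => insert C.out (C.src '' S)) h2).trans (IsCertificate.eq_gates hq).symm)) h2
  · obtain ⟨T, S, h, hx, hy⟩ := IsFlow.exists_isCertificate hp.1 hC hC' hp.2.2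
    exact ⟨(T, S), h, Prod.ext hx hy⟩

/-- An edge inside `T` but outside `S` enters a ∨-gate. Its tail and the tail of the edge of `S`
into that gate mention a common variable by smoothness and form an antichain, as inputs are not
nested. Both lie in `T`, so two units would leave the antichain. -/
theorem IsCertificate.eq_induced (h : C.IsCertificate T S) (hC : C.IsDecomposable)
    (hS : C.IsSmooth) (hC' : C.IsConstantFree) (hN : C.HasNoNestedInputs) :
    S = C.induced T := by
  classical
  refine Set.Subset.antisymm (fun e he => h.ends e he) fun e he => ?_
  by_contra hne
  rcases C.label_dst e with hl | hl
  · exact hne (h.conj _ he.2 hl e rfl)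
  obtain ⟨e₀, ⟨hd, h₀⟩, -⟩ := h.disj _ he.2 hl
  have hs : C.src e ≠ C.src e₀ := fun hs => hne (C.eq_of_src_eq_of_dst_eq hs hd.symm ▸ h₀)
  have hw : C.Wire (C.src e) (C.dst e) := C.wire_src_dst e
  have hw₀ : C.Wire (C.src e₀) (C.dst e) := ⟨e₀, rfl, hd⟩
  obtain ⟨v, hv⟩ := C.vars_nonempty hC' (C.dst e)
  have := h.isSuperflow.sum_outflow_le_one hC {C.src e, C.src e₀} v
    (by
      simp only [Finset.mem_insert, Finset.mem_singleton, forall_eq_or_imp, forall_eq]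
      exact ⟨hS _ _ hl hw ▸ hv, hS _ _ hl hw₀ ▸ hv⟩)
    (by
      simp only [Finset.mem_insert, Finset.mem_singleton, forall_eq_or_imp, forall_eq]
      exact ⟨⟨C.not_transGen_wire _, fun ht => hN _ _ _ hl hw hw₀ hs ht.to_reflTransGen⟩,
        fun ht => hN _ _ _ hl hw₀ hw hs.symm ht.to_reflTransGen, C.not_transGen_wire _⟩)
  rw [Finset.sum_pair hs, h.outflow_eq hC hC', h.outflow_eq hC hC', incidence_of_mem he.1,
    incidence_of_mem (h.ends e₀ h₀).1] at this
  norm_num at this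

theorem bijOn_gateCertificates (hC : C.IsDecomposable) (hS : C.IsSmooth)
    (hC' : C.IsConstantFree) (hN : C.HasNoNestedInputs) :
    Set.BijOn (fun T : Set G => (C.certX T, incidence (C.induced T)))
      {T | C.IsGateCertificate T}
      {p | C.IsFlow p.1 p.2 ∧ (∀ v, ∃ z : ℤ, p.1 v = z) ∧ ∀ e, ∃ z : ℤ, p.2 e = z} := by
  have hb := bijOn_certificates (C := C) hC hC'
  refine ⟨fun T hT => hb.mapsTo (x := (T, C.induced T)) (IsGateCertificate.isCertificate hT),
    fun T hT T' hT' h => ?_, fun p hp => ?_⟩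
  · exact (Prod.ext_iff.1 (hb.injOn (x₁ := (T, C.induced T)) (x₂ := (T', C.induced T'))
      (IsGateCertificate.isCertificate hT) (IsGateCertificate.isCertificate hT') h)).1
  · obtain ⟨⟨T, S⟩, h, rfl⟩ := hb.surjOn hp
    have hT : C.IsCertificate T S := h
    obtain rfl := hT.eq_induced hC hS hC' hN
    exact ⟨T, hT.isGateCertificate, rfl⟩

end Certificates

end NNF

namespace NNF

/-! ### The flow system projects onto the convex hull -/

section Hull

variable {V G E : Type*} [Fintype G] [Fintype E] {C : NNF V G E} {x : V → ℝ} {y : E → ℝ}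

/-- Acyclicity allows recursion from the output downwards: the outflow of a gate is the sum of the
outflows at the heads of its selected outgoing edges, plus the unit at the output. -/
theorem exists_flow_recursion (C : NNF V G E) (p : E → Prop) :
    ∃ y : E → ℝ, (∀ e, 0 ≤ y e) ∧ (∀ e, p e → y e = C.outflow y (C.dst e)) ∧
      ∀ e, ¬ p e → y e = 0 := by
  classical
  let F : G → ℝ := C.wellFounded_flip_wire.fix fun g ih =>
    (∑ e, if h : C.src e = g ∧ p e then ih (C.dst e) ⟨e, h.1, rfl⟩ else 0) +
      if g = C.out then 1 else 0
  have hF : ∀ g, F g = (∑ e with C.src e = g, if p e then F (C.dst e) else 0) +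
      if g = C.out then 1 else 0 := by
    intro g
    rw [show F g = _ from C.wellFounded_flip_wire.fix_eq _ g, Finset.sum_filter]
    congr 1
    refine Finset.sum_congr rfl fun e _ => ?_
    by_cases hs : C.src e = g <;> by_cases hp : p e <;> simp [hs, hp, F]
  have h0 : ∀ g, 0 ≤ F g := by
    intro g
    induction g using C.wellFounded_flip_wire.induction with
    | _ g ih =>
      rw [hF]
      refine add_nonneg (Finset.sum_nonneg fun e he => ?_) (by split_ifs <;> norm_num)
      split_ifs
      · exact ih _ ⟨e, (Finset.mem_filter.1 he).2, rfl⟩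
      · exact le_rfl
  refine ⟨fun e => if p e then F (C.dst e) else 0, fun e => ?_, fun e he => ?_,
    fun e he => if_neg he⟩
  · simp only
    split_ifs
    · exact h0 _
    · exact le_rfl
  · simp only [if_pos he]
    rw [hF]
    unfold outflow
    congr!

/-- Every satisfying assignment is the projection of a flow. -/
theorem exists_isFlow_point (hC : C.IsDecomposable) (hS : C.IsSmooth)
    (hv : C.vars C.out = Set.univ) {τ : V → Bool} (hτ : τ ∈ C.models) :
    ∃ y : E → ℝ, C.IsFlow (point τ) y := by
  classical
  -- One edge with satisfied tail is selected at each satisfied ∨-gate. The default `none` at other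
  -- gates is needed because `E` may be empty.
  have hch : ∀ g, ∃ e₀ : Option E, C.label g = .disj → C.Eval τ g →
      ∃ e, e₀ = some e ∧ C.dst e = g ∧ C.Eval τ (C.src e) := by
    intro g
    by_cases h : C.label g = .disj ∧ C.Eval τ g
    · obtain ⟨hl, he⟩ := h
      cases he with
      | one h => rw [hl] at h; cases h
      | lit h _ => rw [hl] at h; cases h
      | conj h _ => rw [hl] at h; cases h
      | disj _ hw he =>
        obtain ⟨e, rfl, hd⟩ := hw
        exact ⟨some e, fun _ _ => ⟨e, rfl, hd, he⟩⟩
    · exact ⟨none, fun h1 h2 => absurd ⟨h1, h2⟩ h⟩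
  choose ch hch using hch
  -- Flow is allowed on every edge into a satisfied ∧-gate and on the selected edge into a satisfied
  -- ∨-gate.
  obtain ⟨y, h0, h1, h2⟩ := C.exists_flow_recursion fun e =>
    C.Eval τ (C.dst e) ∧ (C.label (C.dst e) = .disj → ch (C.dst e) = some e)
  have hsrc : ∀ e, ¬ C.Eval τ (C.src e) → y e = 0 := by
    intro e he
    refine h2 e ?_
    rintro ⟨ht, hc⟩
    rcases C.label_dst e with hl | hl
    · cases ht with
      | one h => rw [hl] at h; cases h
      | lit h _ => rw [hl] at h; cases h
      | disj h _ _ => rw [hl] at h; cases h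
      | conj _ h => exact he (h _ (C.wire_src_dst e))
    · obtain ⟨e', h', -, ht'⟩ := hch _ hl ht
      rw [hc hl, Option.some_inj] at h'
      exact he (h' ▸ ht')
  have hfalse : ∀ g, ¬ C.Eval τ g → C.outflow y g = 0 := by
    intro g hg
    have ho : g ≠ C.out := fun ho => hg (ho ▸ hτ)
    unfold outflow
    rw [if_neg ho, add_zero]
    refine Finset.sum_eq_zero fun e he => hsrc e ?_
    rwa [(Finset.mem_filter.1 he).2]
  -- The projection is first taken as a definition of `x`. It equals the point of `τ` because
  -- literals false under `τ` receive no flow, while both polarities of a variable together receive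
  -- one unit.
  have hflow : C.IsFlow
      (fun v => ∑ g with C.label g = .lit v true, C.outflow y g) y := by
    refine ⟨h0, fun g hg => ?_, fun e he => ?_, fun g hg => hfalse g fun h => ?_, fun v => rfl⟩
    · by_cases ht : C.Eval τ g
      · obtain ⟨e, he, rfl, -⟩ := hch g hg ht
        rw [Finset.sum_eq_single e]
        · exact h1 e ⟨ht, fun _ => he⟩
        · intro e' he' hne
          have hd := (Finset.mem_filter.1 he').2
          refine h2 e' fun h => hne ?_
          have := h.2 (hd ▸ hg)
          rw [hd, he, Option.some_inj] at this
          exact this.symm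
        · exact fun hn => (hn (Finset.mem_filter.2 ⟨Finset.mem_univ _, rfl⟩)).elim
      · rw [hfalse g ht]
        exact Finset.sum_eq_zero fun e he => h2 e fun h => ht ((Finset.mem_filter.1 he).2 ▸ h.1)
    · by_cases ht : C.Eval τ (C.dst e)
      · exact h1 e ⟨ht, fun h => by rw [he] at h; cases h⟩
      · rw [hfalse _ ht]
        exact h2 e fun h => ht h.1
    · cases h with
      | one h => rw [hg] at h; cases h
      | lit h _ => rw [hg] at h; cases h
      | disj h _ _ => rw [hg] at h; cases h
      | conj h _ => rw [hg] at h; cases h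
  have hlit : ∀ v b, τ v ≠ b → ∑ g with C.label g = .lit v b, C.outflow y g = 0 := by
    intro v b hb
    refine Finset.sum_eq_zero fun g hg => hfalse g fun h => ?_
    have hl := (Finset.mem_filter.1 hg).2
    cases h with
    | one h => rw [hl] at h; cases h
    | lit h h' => rw [hl] at h; cases h; exact hb h'
    | disj h _ _ => rw [hl] at h; cases h
    | conj h _ => rw [hl] at h; cases h
  refine ⟨y, ?_⟩
  convert hflow using 1
  funext v
  have hsum := hflow.sum_outflow_pos_add_neg hC hS (v := v) (by rw [hv]; trivial)
  by_cases hb : τ v = true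
  · rw [hlit v false (by simp [hb])] at hsum
    simp only [point, hb, if_true]
    linarith
  · rw [hlit v true hb]
    simp [point, hb]

/-- The vanishing at gates labelled `0` spreads upwards. All inputs of an unsatisfiable ∨-gate are
unsatisfiable. An unsatisfiable ∧-gate has an unsatisfiable input, as assignments could be glued
otherwise, and the edge from it carries the gate's full outflow. -/
theorem IsFlow.outflow_eq_zero_of_unsat (h : C.IsFlow x y) (hC : C.IsDecomposable) (g : G)
    (hg : ¬ ∃ τ, C.Eval τ g) : C.outflow y g = 0 := by
  classical
  induction g using C.wellFounded_wire.induction with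
  | _ g ih =>
    cases hl : C.label g with
    | const b =>
      cases b with
      | false => exact h.zero g hl
      | true => exact absurd ⟨fun _ => true, .one hl⟩ hg
    | lit v b => exact absurd ⟨fun _ => b, .lit hl rfl⟩ hg
    | disj =>
      rw [← h.disj g hl]
      refine Finset.sum_eq_zero fun e he => ?_
      have hw : C.Wire (C.src e) g := ⟨e, rfl, (Finset.mem_filter.1 he).2⟩
      have := ih _ hw fun ⟨τ, hτ⟩ => hg ⟨τ, .disj hl hw hτ⟩
      exact le_antisymm (this ▸ le_outflow_src h.nonneg e) (h.nonneg e)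
    | conj =>
      have hex : ∃ a, C.Wire a g ∧ ¬ ∃ τ, C.Eval τ a := by
        by_contra hne
        push Not at hne
        choose! τ hτ using hne
        obtain ⟨σ, hσ, -⟩ := hC.exists_glue hl τ hτ
        exact hg ⟨σ, hσ⟩
      obtain ⟨a, ⟨e, rfl, rfl⟩, ha⟩ := hex
      have := ih _ (C.wire_src_dst e) ha
      rw [← h.conj e hl]
      exact le_antisymm (this ▸ le_outflow_src h.nonneg e) (h.nonneg e)

open Classical in
/-- The value of an assignment on the variables below a gate. -/
noncomputable def valueBelow [Fintype V] (C : NNF V G E) (c : V → ℝ) (τ : V → Bool) (g : G) : ℝ :=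
  ∑ v, if v ∈ C.vars g then c v * point τ v else 0

theorem convex_isFlow (C : NNF V G E) : Convex ℝ {x | ∃ y : E → ℝ, C.IsFlow x y} := by
  classical
  rintro x ⟨y, h⟩ x' ⟨y', h'⟩ a b ha hb hab
  have hout : ∀ g, C.outflow (a • y + b • y') g = a * C.outflow y g + b * C.outflow y' g := by
    intro g
    simp only [outflow, Pi.add_apply, Pi.smul_apply, smul_eq_mul, Finset.sum_add_distrib,
      ← Finset.mul_sum]
    split_ifs
    -- At the output the extra unit splits as `a + b = 1`.
    · linear_combination -hab
    · ring
  refine ⟨a • y + b • y', fun e => ?_, fun g hg => ?_, fun e he => ?_, fun g hg => ?_,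
    fun v => ?_⟩
  · exact add_nonneg (mul_nonneg ha (h.nonneg e)) (mul_nonneg hb (h'.nonneg e))
  · rw [hout, ← h.disj g hg, ← h'.disj g hg]
    simp only [Pi.add_apply, Pi.smul_apply, smul_eq_mul, Finset.sum_add_distrib, Finset.mul_sum]
  · rw [hout, ← h.conj e he, ← h'.conj e he]
    rfl
  · rw [hout, h.zero g hg, h'.zero g hg, mul_zero, mul_zero, add_zero]
  · simp only [hout, Pi.add_apply, Pi.smul_apply, smul_eq_mul, Finset.sum_add_distrib,
      ← Finset.mul_sum, h.proj v, h'.proj v]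

variable [Fintype V]

open Classical in
/-- Along a flow, every linear functional is bounded by its maximum over the satisfying
assignments. -/
theorem IsFlow.exists_model_ge (h : C.IsFlow x y) (hC : C.IsDecomposable) (hS : C.IsSmooth)
    (hv : C.vars C.out = Set.univ) (c : V → ℝ) :
    ∃ τ ∈ C.models, ∑ v, c v * x v ≤ ∑ v, c v * point τ v := by
  have hbest : ∀ g, ∃ τ : V → Bool, (∃ τ, C.Eval τ g) →
      C.Eval τ g ∧ ∀ σ, C.Eval σ g → C.valueBelow c σ g ≤ C.valueBelow c τ g := by
    intro g
    by_cases hg : ∃ τ, C.Eval τ g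
    · obtain ⟨τ, h1, h2⟩ := Set.exists_max_image {τ | C.Eval τ g} (fun τ => C.valueBelow c τ g)
        (Set.toFinite _) hg
      exact ⟨τ, fun _ => ⟨h1, h2⟩⟩
    · exact ⟨fun _ => true, fun h => absurd h hg⟩
  choose best hbest using hbest
  -- The dual solution. Its value at unsatisfiable gates is arbitrary, which is harmless because
  -- they carry no flow.
  let M : G → ℝ := fun g => C.valueBelow c (best g) g
  have hin : ∀ g, ¬ (C.label g).IsLeaf →
      ∑ e with C.dst e = g, y e * M (C.src e) ≤ C.outflow y g * M g := by
    intro g hg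
    by_cases hsat : ∃ τ, C.Eval τ g
    · obtain ⟨e₀, rfl⟩ := C.exists_dst_eq hg
      rcases C.label_dst e₀ with hl | hl
      · have hev : ∀ a, C.Wire a (C.dst e₀) → C.Eval (best a) a := by
          intro a ha
          refine (hbest a ?_).1
          obtain ⟨τ, hτ⟩ := hsat
          cases hτ with
          | one h => rw [hl] at h; cases h
          | lit h _ => rw [hl] at h; cases h
          | disj h _ _ => rw [hl] at h; cases h
          | conj _ h => exact ⟨τ, h a ha⟩
        -- Optimal assignments of the inputs glue, and their values add up because the inputs of the
        -- ∧-gate partition its variables. The glued assignment competes in the maximum at the gate.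
        obtain ⟨σ, hσ, hσ'⟩ := hC.exists_glue hl best hev
        have hsum : ∑ e with C.dst e = C.dst e₀, M (C.src e) = C.valueBelow c σ (C.dst e₀) := by
          simp only [M, valueBelow]
          rw [Finset.sum_comm]
          refine Finset.sum_congr rfl fun v _ => ?_
          by_cases hvg : v ∈ C.vars (C.dst e₀)
          · obtain ⟨e, hd, he⟩ := (C.mem_vars_of_not_isLeaf hg).1 hvg
            rw [if_pos hvg, Finset.sum_eq_single e, if_pos he]
            · unfold point
              rw [hσ' _ ⟨e, rfl, hd⟩ v he]
            · intro e' he' hne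
              have hd' := (Finset.mem_filter.1 he').2
              exact if_neg fun hw =>
                hne (hC.eq_of_mem_vars (hd'.trans hd.symm) (hd' ▸ hl) hw he)
            · exact fun hn => (hn (Finset.mem_filter.2 ⟨Finset.mem_univ _, hd⟩)).elim
          · rw [if_neg hvg]
            refine Finset.sum_eq_zero fun e he => if_neg fun hw => hvg ?_
            exact C.vars_subset_of_wire ⟨e, rfl, (Finset.mem_filter.1 he).2⟩ hw
        calc ∑ e with C.dst e = C.dst e₀, y e * M (C.src e)
            = ∑ e with C.dst e = C.dst e₀, C.outflow y (C.dst e₀) * M (C.src e) := by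
              refine Finset.sum_congr rfl fun e he => ?_
              have hd := (Finset.mem_filter.1 he).2
              rw [h.conj e (hd ▸ hl), hd]
          _ = C.outflow y (C.dst e₀) * C.valueBelow c σ (C.dst e₀) := by
              rw [← Finset.mul_sum, hsum]
          _ ≤ _ := mul_le_mul_of_nonneg_left ((hbest _ hsat).2 σ hσ) (outflow_nonneg h.nonneg _)
      · rw [← h.disj _ hl, Finset.sum_mul]
        refine Finset.sum_le_sum fun e he => ?_
        have hw : C.Wire (C.src e) (C.dst e₀) := ⟨e, rfl, (Finset.mem_filter.1 he).2⟩
        by_cases hs : ∃ τ, C.Eval τ (C.src e)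
        · refine mul_le_mul_of_nonneg_left ?_ (h.nonneg e)
          -- By smoothness the input and the ∨-gate evaluate the functional on the same variables,
          -- so the two maxima are comparable.
          have : M (C.src e) = C.valueBelow c (best (C.src e)) (C.dst e₀) := by
            simp only [M, valueBelow, hS _ _ hl hw]
          rw [this]
          exact (hbest _ hsat).2 _ (.disj hl hw (hbest _ hs).1)
        · have h1 := h.outflow_eq_zero_of_unsat hC _ hs
          have h2 : y e = 0 := le_antisymm (h1 ▸ le_outflow_src h.nonneg e) (h.nonneg e)
          rw [h2, zero_mul, zero_mul]
    · rw [h.outflow_eq_zero_of_unsat hC g hsat, zero_mul]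
      refine (Finset.sum_eq_zero fun e he => ?_).le
      have hd := (Finset.mem_filter.1 he).2
      subst hd
      rcases C.label_dst e with hl | hl
      · rw [h.conj e hl, h.outflow_eq_zero_of_unsat hC _ hsat, zero_mul]
      · have hs : ¬ ∃ τ, C.Eval τ (C.src e) := fun ⟨τ, hτ⟩ =>
          hsat ⟨τ, .disj hl (C.wire_src_dst e) hτ⟩
        have h1 := h.outflow_eq_zero_of_unsat hC _ hs
        have h2 : y e = 0 := le_antisymm (h1 ▸ le_outflow_src h.nonneg e) (h.nonneg e)
        rw [h2, zero_mul]
  -- A literal forces the value of its variable, hence its `M` is the coefficient or zero; a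
  -- constant mentions no variable.
  have hleaf : ∀ g, (C.label g).IsLeaf → C.outflow y g * M g
      = ∑ v, if C.label g = .lit v true then c v * C.outflow y g else 0 := by
    intro g hg
    simp only [M, valueBelow, C.mem_vars_of_isLeaf hg]
    cases hl : C.label g with
    | const b => simp
    | lit v b =>
      have hb := (hbest g ⟨fun _ => b, .lit hl rfl⟩).1
      have : best g v = b := by
        cases hb with
        | one h => rw [hl] at h; cases h
        | lit h h' => rw [hl] at h; cases h; exact h'
        | disj h _ _ => rw [hl] at h; cases h
        | conj h _ => rw [hl] at h; cases h
      cases b <;> simp [point, this, mul_comm]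
    | conj => simp [hl, GateLabel.IsLeaf] at hg
    | disj => simp [hl, GateLabel.IsLeaf] at hg
  have hobj : ∑ v, c v * x v
      = ∑ g, ∑ v, if C.label g = .lit v true then c v * C.outflow y g else 0 := by
    rw [Finset.sum_comm]
    refine Finset.sum_congr rfl fun v _ => ?_
    rw [h.proj, Finset.mul_sum, Finset.sum_filter]
  have hout : ∃ τ, C.Eval τ C.out := by
    by_contra hne
    have := one_le_outflow_out (C := C) h.nonneg
    rw [h.outflow_eq_zero_of_unsat hC _ hne] at this
    norm_num at this
  refine ⟨best C.out, (hbest _ hout).1, ?_⟩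
  have hMo : M C.out = ∑ v, c v * point (best C.out) v := by
    simp only [M, valueBelow, hv, Set.mem_univ, if_true]
  have h1 := C.sum_outflow_mul y M
  have h2 : ∑ e, y e * M (C.src e) = ∑ g, ∑ e with C.dst e = g, y e * M (C.src e) :=
    (Finset.sum_fiberwise Finset.univ C.dst _).symm
  have h3 : ∑ g, ((∑ v, if C.label g = .lit v true then c v * C.outflow y g else 0)
      + ∑ e with C.dst e = g, y e * M (C.src e)) ≤ ∑ g, C.outflow y g * M g := by
    refine Finset.sum_le_sum fun g _ => ?_
    by_cases hg : (C.label g).IsLeaf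
    · have : (Finset.univ.filter fun e => C.dst e = g) = ∅ :=
        Finset.filter_eq_empty_iff.2 fun e _ => C.dst_ne_of_isLeaf hg e
      rw [this, Finset.sum_empty, add_zero, hleaf g hg]
    · have : ∀ v, C.label g ≠ .lit v true := fun v hl => hg (hl ▸ trivial)
      simpa [this] using hin g hg
  rw [Finset.sum_add_distrib, ← hobj] at h3
  linarith

/-- The projection of the flow system of a smooth DNNF is its convex hull. -/
theorem conv_eq_setOf_isFlow (hC : C.IsDecomposable) (hS : C.IsSmooth)
    (hv : C.vars C.out = Set.univ) : C.conv = {x | ∃ y : E → ℝ, C.IsFlow x y} := by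
  classical
  refine Set.Subset.antisymm (convexHull_min ?_ C.convex_isFlow) ?_
  · rintro _ ⟨τ, hτ, rfl⟩
    exact exists_isFlow_point hC hS hv hτ
  · rintro x ⟨y, h⟩
    by_contra hx
    have hclosed : IsClosed C.conv :=
      (Set.toFinite (point '' C.models)).isClosed_convexHull ℝ
    -- A functional separating `x` from the hull would be larger at `x` than at every model, against
    -- `IsFlow.exists_model_ge`.
    obtain ⟨f, u, hf, hu⟩ :=
      geometric_hahn_banach_closed_point (convex_convexHull ℝ _) hclosed hx
    obtain ⟨τ, hτ, hle⟩ := h.exists_model_ge hC hS hv fun v => f (Pi.single v 1)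
    have hfx : ∀ z : V → ℝ, f z = ∑ v, f (Pi.single v 1) * z v := by
      intro z
      conv_lhs => rw [← Finset.univ_sum_single z]
      rw [map_sum]
      refine Finset.sum_congr rfl fun v _ => ?_
      rw [mul_comm, ← smul_eq_mul, ← map_smul]
      congr 1
      rw [← Pi.single_smul, smul_eq_mul, mul_one]
    have := hf _ (subset_convexHull ℝ _ ⟨τ, hτ, rfl⟩)
    rw [hfx] at this hu
    linarith

end Hull

end NNF

/-! ### Matrices given by lists of signed entries -/

section SignedEntries

variable {R Q : Type*}

/-- The sign that is coded by a Boolean. -/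
def signOf : Bool → ℝ
  | true => 1
  | false => -1

open Classical in
/-- The matrix whose nonzero entries are listed in `L`. -/
noncomputable def entryMatrix (L : List (R × Q × Bool)) (r : R) (q : Q) : ℝ :=
  if (r, q, true) ∈ L then 1 else if (r, q, false) ∈ L then -1 else 0

open Classical in
/-- The value of the linear form in row `r` of the matrix listed in `L`. -/
noncomputable def rowForm (L : List (R × Q × Bool)) (r : R) (y : Q → ℝ) : ℝ :=
  (L.map fun p => if p.1 = r then signOf p.2.2 * y p.2.1 else 0).sum

theorem entryMatrix_mem (L : List (R × Q × Bool)) (r : R) (q : Q) :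
    entryMatrix L r q ∈ ({-1, 0, 1} : Set ℝ) := by
  unfold entryMatrix
  split_ifs <;> simp

theorem not_mem_of_key_notMem {L : List (R × Q × Bool)} {r : R} {q : Q}
    (h : (r, q) ∉ L.map fun p => (p.1, p.2.1)) (b : Bool) : (r, q, b) ∉ L :=
  fun hm => h (List.mem_map.2 ⟨_, hm, rfl⟩)

/-- As no position is listed twice, reading a coefficient by membership agrees with adding up the
listed entries. -/
theorem sum_entryMatrix_mul [Fintype Q] {L : List (R × Q × Bool)}
    (hL : (L.map fun p => (p.1, p.2.1)).Nodup) (r : R) (y : Q → ℝ) :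
    ∑ q, entryMatrix L r q * y q = rowForm L r y := by
  classical
  induction L with
  | nil => simp [entryMatrix, rowForm]
  | cons p L ih =>
    obtain ⟨r', q', b⟩ := p
    rw [List.map_cons, List.nodup_cons] at hL
    have hcons : ∀ q, entryMatrix ((r', q', b) :: L) r q
        = (if r' = r ∧ q' = q then signOf b else 0) + entryMatrix L r q := by
      intro q
      by_cases h : r' = r ∧ q' = q
      · obtain ⟨rfl, rfl⟩ := h
        have h1 := not_mem_of_key_notMem hL.1 true
        have h2 := not_mem_of_key_notMem hL.1 false
        cases b <;> simp [entryMatrix, h1, h2, signOf]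
      · have h' : ¬ (r = r' ∧ q = q') := fun h' => h ⟨h'.1.symm, h'.2.symm⟩
        have : ∀ c, (r, q, c) ∈ (r', q', b) :: L ↔ (r, q, c) ∈ L := by
          intro c
          rw [List.mem_cons, or_iff_right]
          intro he
          rw [Prod.ext_iff, Prod.ext_iff] at he
          exact h' ⟨he.1, he.2.1⟩
        rw [if_neg h, zero_add]
        simp only [entryMatrix, this]
    simp only [hcons, add_mul, Finset.sum_add_distrib, ih hL.2]
    simp only [rowForm, List.map_cons, List.sum_cons]
    congr 1
    by_cases h : r' = r <;> simp [h]

theorem entryMatrix_eq_iff {L : List (R × Q × Bool)}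
    (hL : (L.map fun p => (p.1, p.2.1)).Nodup) (r : R) (q : Q) {a : ℝ} (ha : a ≠ 0) :
    entryMatrix L r q = a ↔ ∃ b, (r, q, b) ∈ L ∧ signOf b = a := by
  have hu : (r, q, true) ∈ L → (r, q, false) ∉ L := by
    intro h h'
    have := List.inj_on_of_nodup_map hL h h' rfl
    simp at this
  unfold entryMatrix
  constructor
  · intro h
    split_ifs at h with h1 h2
    · exact ⟨true, h1, h⟩
    · exact ⟨false, h2, h⟩
    · exact absurd h.symm ha
  · rintro ⟨b, hb, rfl⟩
    cases b with
    | true => rw [if_pos hb]; rfl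
    | false => rw [if_neg fun h => hu h hb, if_pos hb]; rfl

/-- The numerical code of a sign. -/
def signCode : Bool → ℕ
  | true => 1
  | false => 2

theorem decodeCoeff_signCode (b : Bool) : decodeCoeff (signCode b) = signOf b := by
  cases b <;> rfl

theorem signCode_eq (b : Bool) : signCode b = 1 ∨ signCode b = 2 := by
  cases b <;> simp [signCode]

/-- The numerical code of a signed entry. -/
def entryCode {r c : ℕ} (ρ : R ≃ Fin r) (p : R × Fin c × Bool) : ℕ × ℕ × ℕ :=
  (ρ p.1, p.2.1, signCode p.2.2)

theorem isSparseList_entryMatrix {r c : ℕ} (ρ : R ≃ Fin r) {L : List (R × Fin c × Bool)}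
    (hL : (L.map fun p => (p.1, p.2.1)).Nodup) {row col val : ℕ → ℕ}
    (h : ∀ t (ht : t < L.length), (row t, col t, val t) = entryCode ρ L[t]) :
    IsSparseList (fun i j => entryMatrix L (ρ.symm i) j) L.length row col val := by
  have h1 : ∀ t (ht : t < L.length), row t = ρ L[t].1 := fun t ht => (Prod.ext_iff.1 (h t ht)).1
  have h2 : ∀ t (ht : t < L.length), col t = L[t].2.1 := fun t ht =>
    (Prod.ext_iff.1 (Prod.ext_iff.1 (h t ht)).2).1
  have h3 : ∀ t (ht : t < L.length), val t = signCode L[t].2.2 := fun t ht =>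
    (Prod.ext_iff.1 (Prod.ext_iff.1 (h t ht)).2).2
  refine ⟨fun t ht => ?_, fun t ht t' ht' hr hc => ?_, fun i j a ha => ?_⟩
  · rw [h1 t ht, h2 t ht, h3 t ht]
    exact ⟨Fin.is_lt _, Fin.is_lt _, signCode_eq _⟩
  · rw [h1 t ht, h1 t' ht'] at hr
    rw [h2 t ht, h2 t' ht'] at hc
    have := hL.getElem_inj_iff (i := t) (j := t') (hi := by simpa using ht)
      (hj := by simpa using ht')
    rw [← this]
    simp only [List.getElem_map, Prod.mk.injEq]
    exact ⟨ρ.injective (Fin.ext hr), Fin.ext hc⟩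
  · rw [entryMatrix_eq_iff hL _ j ha]
    constructor
    · rintro ⟨b, hb, rfl⟩
      obtain ⟨t, ht, hLt⟩ := List.mem_iff_getElem.1 hb
      refine ⟨t, ht, ?_, ?_, ?_⟩
      · rw [h1 t ht, hLt, ρ.apply_symm_apply]
      · rw [h2 t ht, hLt]
      · rw [h3 t ht, hLt, decodeCoeff_signCode]
    · rintro ⟨t, ht, hr, hc, hv⟩
      rw [h1 t ht] at hr
      rw [h2 t ht] at hc
      rw [h3 t ht, decodeCoeff_signCode] at hv
      refine ⟨L[t].2.2, ?_, hv⟩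
      rw [← ρ.eq_symm_apply.2 (Fin.ext hr), ← Fin.ext hc]
      exact List.getElem_mem ht

theorem rowForm_append (L L' : List (R × Q × Bool)) (r : R) (y : Q → ℝ) :
    rowForm (L ++ L') r y = rowForm L r y + rowForm L' r y := by
  simp [rowForm]

theorem rowForm_flatMap_finRange {N : ℕ} (f : Fin N → List (R × Q × Bool)) (r : R) (y : Q → ℝ) :
    rowForm ((List.finRange N).flatMap f) r y = ∑ i, rowForm (f i) r y := by
  rw [Fin.sum_univ_def]
  induction List.finRange N with
  | nil => simp [rowForm]
  | cons i l ih => rw [List.flatMap_cons, rowForm_append, ih, List.map_cons, List.sum_cons]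

/-- The function `owner` recovers from a position the only block that can write it, so different
blocks do not collide. -/
theorem nodup_keys_flatMap_finRange {N : ℕ} (f : Fin N → List (R × Q × Bool))
    (owner : R × Q → Fin N) (h1 : ∀ i, ((f i).map fun p => (p.1, p.2.1)).Nodup)
    (h2 : ∀ i, ∀ p ∈ f i, owner (p.1, p.2.1) = i) :
    (((List.finRange N).flatMap f).map fun p => (p.1, p.2.1)).Nodup := by
  rw [List.map_flatMap, List.nodup_flatMap]
  refine ⟨fun i _ => h1 i, (List.nodup_finRange N).imp fun {i j} hij => ?_⟩
  intro k hk hk'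
  obtain ⟨p, hp, rfl⟩ := List.mem_map.1 hk
  obtain ⟨q, hq, hqp⟩ := List.mem_map.1 hk'
  exact hij ((h2 i p hp).symm.trans (hqp ▸ h2 j q hq))

end SignedEntries

namespace NNF

/-! ### The inequalities, with boundedly many coefficients per edge -/

section System

variable {k n m : ℕ}

/-- The rows of the system: four for each edge, two for each variable, and one for the output. -/
abbrev SysRow (k m : ℕ) : Type := (Fin m × Fin 4) ⊕ ((Fin k × Fin 2) ⊕ Fin 1)

/-- The numbering of the rows. -/
def rowEquiv (k m : ℕ) : SysRow k m ≃ Fin (m * 4 + (k * 2 + 1)) :=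
  (Equiv.sumCongr finProdFinEquiv
    ((Equiv.sumCongr finProdFinEquiv (Equiv.refl _)).trans finSumFinEquiv)).trans finSumFinEquiv

theorem rowEquiv_edge (e : Fin m) (i : Fin 4) :
    (rowEquiv k m (.inl (e, i)) : ℕ) = 4 * e + i := by
  simp [rowEquiv, add_comm]

theorem rowEquiv_var (v : Fin k) (i : Fin 2) :
    (rowEquiv k m (.inr (.inl (v, i))) : ℕ) = 4 * m + 2 * v + i := by
  simp [rowEquiv]
  ring

theorem rowEquiv_out (i : Fin 1) :
    (rowEquiv k m (.inr (.inr i)) : ℕ) = 4 * m + 2 * k := by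
  simp [rowEquiv]
  ring

/-- The coefficient `b` in the first row of the equation of the edge `l` and its negative in the
second row. -/
def eqPair (k : ℕ) (l e : Fin m) (b : Bool) : List (SysRow k m × Fin m × Bool) :=
  [(.inl (l, 1), e, b), (.inl (l, 2), e, !b)]

/-- The coefficient `b` in the first row of the equation of the variable `v` and its negative in the
second row. -/
def varPair {Q : Type*} (m : ℕ) (v : Fin k) (q : Q) (b : Bool) : List (SysRow k m × Q × Bool) :=
  [(.inr (.inl (v, 0)), q, b), (.inr (.inl (v, 1)), q, !b)]

open Classical in
/-- The coefficients that are caused by the edge `e` as an edge into its head. -/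
noncomputable def headEntries (C : NNF (Fin k) (Fin n) (Fin m)) (lead : Fin n → Option (Fin m))
    (e : Fin m) : List (SysRow k m × Fin m × Bool) :=
  match lead (C.dst e) with
  | none => []
  | some l =>
    -- All edges into a ∨-gate enter the one equation of its leading edge. At an ∧-gate only the
    -- leading edge is compared with the outflow; any other edge `e` gets the equation `y e = y l`.
    if C.label (C.dst e) = .disj then eqPair k l e true
    else eqPair k e e true ++ if e = l then [] else eqPair k e l false

/-- The coefficients that are caused by the edge `e` as an edge out of its tail. -/
def tailEntries (C : NNF (Fin k) (Fin n) (Fin m)) (lead : Fin n → Option (Fin m))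
    (e : Fin m) : List (SysRow k m × Fin m × Bool) :=
  match lead (C.src e), C.label (C.src e) with
  | some l, _ => eqPair k l e false
  | none, .lit v true => varPair m v e false
  -- Together with nonnegativity, `y e ≤ 0` on each edge out of a gate labelled `0` makes its edge
  -- flow vanish.
  | none, .const false => [(.inl (e, 3), e, true)]
  | none, _ => []

/-- The coefficients of the edge variables that are written when `e` is read. -/
noncomputable def edgeEntries (C : NNF (Fin k) (Fin n) (Fin m)) (lead : Fin n → Option (Fin m))
    (e : Fin m) : List (SysRow k m × Fin m × Bool) :=
  (.inl (e, 0), e, false) :: (headEntries C lead e ++ tailEntries C lead e)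

/-- The coefficients of the edge variables. -/
noncomputable def edgeList (C : NNF (Fin k) (Fin n) (Fin m)) (lead : Fin n → Option (Fin m)) :
    List (SysRow k m × Fin m × Bool) :=
  (List.finRange m).flatMap (edgeEntries C lead)

/-- The coefficients of the variables of the circuit. -/
def varList (k m : ℕ) : List (SysRow k m × Fin k × Bool) :=
  (List.finRange k).flatMap fun v => varPair m v v true

open Classical in
/-- The right hand side of the system. -/
noncomputable def sysRhs (C : NNF (Fin k) (Fin n) (Fin m)) (lead : Fin n → Option (Fin m)) :
    SysRow k m → ℝ
  | .inl (l, 1) => if lead C.out = some l then 1 else 0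
  | .inl (l, 2) => if lead C.out = some l then -1 else 0
  | .inl (_, _) => 0
  | .inr (.inl (v, 0)) => if C.label C.out = .lit v true then 1 else 0
  | .inr (.inl (v, 1)) => if C.label C.out = .lit v true then -1 else 0
  -- For an output labelled `0` this row reads `0 ≤ -1`: at least one unit leaves the output, so the
  -- flow system is infeasible.
  | .inr (.inr _) => if C.label C.out = .const false then -1 else 0

/-- `lead` selects an edge into each gate of positive in-degree. -/
structure IsLead (C : NNF (Fin k) (Fin n) (Fin m)) (lead : Fin n → Option (Fin m)) : Prop where
  dst_eq : ∀ g l, lead g = some l → C.dst l = g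
  exists_eq : ∀ e, ∃ l, lead (C.dst e) = some l

variable {C : NNF (Fin k) (Fin n) (Fin m)} {lead : Fin n → Option (Fin m)}

theorem IsLead.isLeaf_of_none (h : C.IsLead lead) {g : Fin n} (hg : lead g = none) :
    (C.label g).IsLeaf := by
  by_contra hl
  obtain ⟨e, rfl⟩ := C.exists_dst_eq hl
  obtain ⟨l, hl⟩ := h.exists_eq e
  rw [hg] at hl
  cases hl

theorem IsLead.eq_none (h : C.IsLead lead) {g : Fin n} (hg : (C.label g).IsLeaf) :
    lead g = none := by
  cases hl : lead g with
  | none => rfl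
  | some l => exact absurd (h.dst_eq g l hl) (C.dst_ne_of_isLeaf hg l)

theorem IsLead.eq_some_iff (h : C.IsLead lead) {l : Fin m} (hl : lead (C.dst l) = some l)
    (g : Fin n) : lead g = some l ↔ g = C.dst l :=
  ⟨fun hg => (h.dst_eq g l hg).symm, fun hg => hg ▸ hl⟩

theorem nodup_varList : ((varList k m).map fun p => (p.1, p.2.1)).Nodup := by
  refine nodup_keys_flatMap_finRange _ (fun p => p.2) (fun v => ?_) fun v p hp => ?_
  · simp [varPair]
  · simp only [varPair, List.mem_cons, List.not_mem_nil, or_false] at hp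
    rcases hp with rfl | rfl <;> rfl

theorem IsLead.nodup_edgeEntries (h : C.IsLead lead) (e : Fin m) :
    ((edgeEntries C lead e).map fun p => (p.1, p.2.1)).Nodup := by
  obtain ⟨l, hl⟩ := h.exists_eq e
  have hd := h.dst_eq _ _ hl
  have hne := C.src_ne_dst e
  unfold edgeEntries headEntries tailEntries
  rw [hl]
  rcases hs : lead (C.src e) with _ | l'
  · rcases hlab : C.label (C.src e) with (_ | _) | ⟨v, (_ | _)⟩ | _ | _ <;>
    · by_cases h1 : C.label (C.dst e) = .disj <;> by_cases h2 : e = l <;>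
      simp [h1, h2, eqPair, varPair]
  · have hd' := h.dst_eq _ _ hs
    have h3 : l ≠ l' := by rintro rfl; exact hne (hd'.symm.trans hd)
    have h4 : e ≠ l' := by rintro rfl; exact hne hd'.symm
    by_cases h1 : C.label (C.dst e) = .disj
    · simp [h1, eqPair, h3]
    · by_cases h2 : e = l
      · simp [h2, eqPair, h3]
      · simp [h1, h2, eqPair, h4]

open Classical in
theorem IsLead.nodup_edgeList (h : C.IsLead lead) :
    ((edgeList C lead).map fun p => (p.1, p.2.1)).Nodup := by
  -- A coefficient is written when the edge of its column is read. The exception is the leading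
  -- edge's coefficient in a row of another edge into the same ∧-gate, written when that other edge
  -- is read.
  let owner : SysRow k m × Fin m → Fin m := fun p =>
    match p.1 with
    | .inl (l, _) =>
      if lead (C.dst l) = some p.2 ∧ C.label (C.dst l) ≠ .disj ∧ l ≠ p.2 then l else p.2
    | _ => p.2
  refine nodup_keys_flatMap_finRange _ owner h.nodup_edgeEntries fun e p hp => ?_
  obtain ⟨l, hl⟩ := h.exists_eq e
  have hd := h.dst_eq _ _ hl
  have hne := C.src_ne_dst e
  unfold edgeEntries headEntries tailEntries at hp
  rw [hl] at hp
  rw [List.mem_cons, List.mem_append] at hp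
  rcases hp with rfl | hp | hp
  · simp [owner]
  · by_cases h1 : C.label (C.dst e) = .disj
    · simp only [h1, if_true, eqPair, List.mem_cons, List.not_mem_nil, or_false] at hp
      rcases hp with rfl | rfl <;> simp [owner, hd, h1]
    · by_cases h2 : e = l
      · simp only [if_neg h1, if_pos h2, List.append_nil, eqPair, List.mem_cons,
          List.not_mem_nil, or_false] at hp
        rcases hp with rfl | rfl <;> simp [owner, h2]
      · simp only [h1, h2, if_false, eqPair, List.mem_cons, List.cons_append, List.nil_append,
          List.not_mem_nil, or_false] at hp
        rcases hp with rfl | rfl | rfl | rfl <;> simp [owner, hl, h1, h2]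
  · rcases hs : lead (C.src e) with _ | l'
    · rw [hs] at hp
      rcases hlab : C.label (C.src e) with (_ | _) | ⟨v, (_ | _)⟩ | _ | _ <;>
        simp only [hlab, varPair, List.mem_cons, List.not_mem_nil, or_false] at hp
      · subst hp
        simp [owner]
      · rcases hp with rfl | rfl <;> simp [owner]
    · rw [hs] at hp
      have hd' := h.dst_eq _ _ hs
      simp only [eqPair, List.mem_cons, List.not_mem_nil, or_false] at hp
      have : lead (C.src e) ≠ some e := fun hc => hne (h.dst_eq _ _ hc).symm
      rcases hp with rfl | rfl <;> simp [owner, hd', this]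

/-! ### The rows -/

open Classical in
theorem rowForm_varList (v : Fin k) (x : Fin k → ℝ) :
    rowForm (varList k m) (.inr (.inl (v, 0))) x = x v ∧
      rowForm (varList k m) (.inr (.inl (v, 1))) x = - x v := by
  unfold varList
  rw [rowForm_flatMap_finRange, rowForm_flatMap_finRange]
  constructor <;> simp [rowForm, varPair, signOf]

theorem rowForm_varList_edge (p : Fin m × Fin 4) (x : Fin k → ℝ) :
    rowForm (varList k m) (.inl p) x = 0 := by
  unfold varList
  rw [rowForm_flatMap_finRange]
  simp [rowForm, varPair]

theorem rowForm_varList_out (i : Fin 1) (x : Fin k → ℝ) :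
    rowForm (varList k m) (.inr (.inr i)) x = 0 := by
  unfold varList
  rw [rowForm_flatMap_finRange]
  simp [rowForm, varPair]

theorem rowForm_nil {R Q : Type*} (r : R) (y : Q → ℝ) : rowForm [] r y = 0 := rfl

open Classical in
theorem rowForm_cons {R Q : Type*} (p : R × Q × Bool) (L : List (R × Q × Bool)) (r : R)
    (y : Q → ℝ) :
    rowForm (p :: L) r y = (if p.1 = r then signOf p.2.2 * y p.2.1 else 0) + rowForm L r y := by
  simp [rowForm]

theorem signOf_not (b : Bool) : signOf (!b) = - signOf b := by cases b <;> simp [signOf]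

section Pairs

variable (y : Fin m → ℝ)

theorem rowForm_eqPair_one (l e : Fin m) (b : Bool) (l₀ : Fin m) :
    rowForm (eqPair k l e b) (.inl (l₀, 1)) y = if l = l₀ then signOf b * y e else 0 := by
  simp [eqPair, rowForm_cons, rowForm_nil]

theorem rowForm_eqPair_two (l e : Fin m) (b : Bool) (l₀ : Fin m) :
    rowForm (eqPair k l e b) (.inl (l₀, 2)) y = - if l = l₀ then signOf b * y e else 0 := by
  simp only [eqPair, rowForm_cons, rowForm_nil, signOf_not]
  by_cases h : l = l₀ <;> simp [h]

theorem rowForm_eqPair_of_ne (l e : Fin m) (b : Bool) {r : SysRow k m} (h1 : r ≠ .inl (l, 1))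
    (h2 : r ≠ .inl (l, 2)) : rowForm (eqPair k l e b) r y = 0 := by
  simp [eqPair, rowForm_cons, rowForm_nil, h1.symm, h2.symm]

open Classical in
theorem rowForm_headEntries (e l₀ : Fin m) {l : Fin m}
    (hl : lead (C.dst e) = some l) :
    rowForm (headEntries C lead e) (.inl (l₀, 1)) y
      = (if C.label (C.dst e) = .disj then if l = l₀ then y e else 0
        else if e = l₀ then (if e = l then y e else y e - y l) else 0) ∧
    rowForm (headEntries C lead e) (.inl (l₀, 2)) y
      = -(if C.label (C.dst e) = .disj then if l = l₀ then y e else 0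
        else if e = l₀ then (if e = l then y e else y e - y l) else 0) := by
  unfold headEntries
  rw [hl]
  by_cases h1 : C.label (C.dst e) = .disj
  · simp [h1, rowForm_eqPair_one, rowForm_eqPair_two, signOf]
  · by_cases h2 : e = l
    · simp [h2, rowForm_eqPair_one, rowForm_eqPair_two, signOf]
    · simp only [h1, h2, if_false, rowForm_append, rowForm_eqPair_one, rowForm_eqPair_two, signOf]
      by_cases h3 : e = l₀
      · simp only [h3, if_true]
        constructor <;> ring
      · simp [h3]

theorem rowForm_headEntries_of_ne (e : Fin m) {r : SysRow k m} (h1 : ∀ l, r ≠ .inl (l, 1))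
    (h2 : ∀ l, r ≠ .inl (l, 2)) : rowForm (headEntries C lead e) r y = 0 := by
  unfold headEntries
  rcases lead (C.dst e) with _ | l
  · exact rowForm_nil _ _
  · dsimp only
    split_ifs
    · exact rowForm_eqPair_of_ne y _ _ _ (h1 _) (h2 _)
    · rw [List.append_nil]
      exact rowForm_eqPair_of_ne y _ _ _ (h1 _) (h2 _)
    · rw [rowForm_append, rowForm_eqPair_of_ne y _ _ _ (h1 _) (h2 _),
        rowForm_eqPair_of_ne y _ _ _ (h1 _) (h2 _), add_zero]

theorem rowForm_tailEntries_nonneg (e l₀ : Fin m) :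
    rowForm (tailEntries C lead e) (.inl (l₀, 0)) y = 0 := by
  unfold tailEntries
  split <;> simp [eqPair, varPair, rowForm_cons, rowForm_nil]

theorem rowForm_tailEntries_out (e : Fin m) (i : Fin 1) :
    rowForm (tailEntries C lead e) (.inr (.inr i)) y = 0 := by
  unfold tailEntries
  split <;> simp [eqPair, varPair, rowForm_cons, rowForm_nil]

theorem rowForm_tailEntries_eq (e l₀ : Fin m) :
    rowForm (tailEntries C lead e) (.inl (l₀, 1)) y
      = (-if lead (C.src e) = some l₀ then y e else 0) ∧
    rowForm (tailEntries C lead e) (.inl (l₀, 2)) y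
      = if lead (C.src e) = some l₀ then y e else 0 := by
  rcases hl : lead (C.src e) with _ | l
  · rcases hlab : C.label (C.src e) with (_ | _) | ⟨v, (_ | _)⟩ | _ | _ <;>
      simp [tailEntries, hl, hlab, varPair, rowForm_cons, rowForm_nil]
  · simp only [tailEntries, hl, rowForm_eqPair_one, rowForm_eqPair_two, Option.some_inj]
    by_cases h : l = l₀ <;> simp [h, signOf]

open Classical in
theorem IsLead.rowForm_tailEntries_zero (h : C.IsLead lead) (e l₀ : Fin m) :
    rowForm (tailEntries C lead e) (.inl (l₀, 3)) y
      = if e = l₀ ∧ C.label (C.src e) = .const false then y e else 0 := by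
  rcases hl : lead (C.src e) with _ | l
  · rcases hlab : C.label (C.src e) with (_ | _) | ⟨v, (_ | _)⟩ | _ | _ <;>
      simp [tailEntries, hl, hlab, varPair, rowForm_cons, rowForm_nil, signOf]
  · have : C.label (C.src e) ≠ .const false := fun hc => by
      rw [h.eq_none (hc ▸ trivial)] at hl
      cases hl
    rw [if_neg fun h => this h.2]
    simp [tailEntries, hl, eqPair, rowForm_cons, rowForm_nil]

open Classical in
theorem IsLead.rowForm_tailEntries_var (h : C.IsLead lead) (e : Fin m) (v : Fin k) :
    rowForm (tailEntries C lead e) (.inr (.inl (v, 0))) y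
      = (-if C.label (C.src e) = .lit v true then y e else 0) ∧
    rowForm (tailEntries C lead e) (.inr (.inl (v, 1))) y
      = if C.label (C.src e) = .lit v true then y e else 0 := by
  rcases hl : lead (C.src e) with _ | l
  · rcases hlab : C.label (C.src e) with (_ | _) | ⟨w, (_ | _)⟩ | _ | _ <;>
      simp [tailEntries, hl, hlab, varPair, rowForm_cons, rowForm_nil, signOf]
    by_cases hw : w = v <;> simp [hw]
  · have : C.label (C.src e) ≠ .lit v true := fun hc => by
      rw [h.eq_none (hc ▸ trivial)] at hl
      cases hl
    rw [if_neg this]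
    simp [tailEntries, hl, eqPair, rowForm_cons, rowForm_nil]

theorem rowForm_edgeList (r : SysRow k m) :
    rowForm (edgeList C lead) r y = ∑ e, ((if r = .inl (e, 0) then - y e else 0)
      + (rowForm (headEntries C lead e) r y + rowForm (tailEntries C lead e) r y)) := by
  unfold edgeList
  rw [rowForm_flatMap_finRange]
  refine Finset.sum_congr rfl fun e _ => ?_
  rw [edgeEntries, rowForm_cons, rowForm_append]
  congr 1
  by_cases h : r = .inl (e, 0)
  · simp [h, signOf]
  · rw [if_neg h, if_neg (Ne.symm h)]

theorem rowForm_edgeList_nonneg (e₀ : Fin m) :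
    rowForm (edgeList C lead) (.inl (e₀, 0)) y = - y e₀ := by
  rw [rowForm_edgeList, Finset.sum_eq_single e₀]
  · rw [rowForm_headEntries_of_ne y _ (by simp) (by simp), rowForm_tailEntries_nonneg]
    simp
  · intro e _ hne
    rw [rowForm_headEntries_of_ne y _ (by simp) (by simp), rowForm_tailEntries_nonneg]
    simp [hne.symm]
  · simp

open Classical in
theorem IsLead.rowForm_edgeList_zero (h : C.IsLead lead) (e₀ : Fin m) :
    rowForm (edgeList C lead) (.inl (e₀, 3)) y
      = if C.label (C.src e₀) = .const false then y e₀ else 0 := by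
  rw [rowForm_edgeList, Finset.sum_eq_single e₀]
  · rw [rowForm_headEntries_of_ne y _ (by simp) (by simp), h.rowForm_tailEntries_zero]
    simp
  · intro e _ hne
    rw [rowForm_headEntries_of_ne y _ (by simp) (by simp), h.rowForm_tailEntries_zero]
    simp [hne]
  · simp

theorem rowForm_edgeList_out (i : Fin 1) :
    rowForm (edgeList C lead) (.inr (.inr i)) y = 0 := by
  rw [rowForm_edgeList]
  refine Finset.sum_eq_zero fun e _ => ?_
  rw [rowForm_headEntries_of_ne y _ (by simp) (by simp), rowForm_tailEntries_out]
  simp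

open Classical in
theorem IsLead.rowForm_edgeList_var (h : C.IsLead lead) (v : Fin k) :
    rowForm (edgeList C lead) (.inr (.inl (v, 0))) y
      = (-∑ e, if C.label (C.src e) = .lit v true then y e else 0) ∧
    rowForm (edgeList C lead) (.inr (.inl (v, 1))) y
      = ∑ e, if C.label (C.src e) = .lit v true then y e else 0 := by
  rw [rowForm_edgeList, rowForm_edgeList, ← Finset.sum_neg_distrib]
  constructor <;>
  · refine Finset.sum_congr rfl fun e _ => ?_
    rw [rowForm_headEntries_of_ne y _ (by simp) (by simp)]
    simp [h.rowForm_tailEntries_var y e v]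

theorem IsLead.rowForm_edgeList_two (h : C.IsLead lead) (l : Fin m) :
    rowForm (edgeList C lead) (.inl (l, 2)) y = - rowForm (edgeList C lead) (.inl (l, 1)) y := by
  rw [rowForm_edgeList, rowForm_edgeList, ← Finset.sum_neg_distrib]
  refine Finset.sum_congr rfl fun e _ => ?_
  obtain ⟨l', hl'⟩ := h.exists_eq e
  rw [(rowForm_headEntries y e l hl').1, (rowForm_headEntries y e l hl').2,
    (rowForm_tailEntries_eq y e l).1, (rowForm_tailEntries_eq y e l).2]
  simp
  ring

open Classical in
theorem IsLead.rowForm_edgeList_disj (h : C.IsLead lead) {l : Fin m}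
    (hl : lead (C.dst l) = some l) (hd : C.label (C.dst l) = .disj) :
    rowForm (edgeList C lead) (.inl (l, 1)) y
      = (∑ e, if C.dst e = C.dst l then y e else 0)
        - ∑ e, if C.src e = C.dst l then y e else 0 := by
  rw [rowForm_edgeList, ← Finset.sum_sub_distrib]
  refine Finset.sum_congr rfl fun e _ => ?_
  obtain ⟨l', hl'⟩ := h.exists_eq e
  rw [(rowForm_headEntries y e l hl').1, (rowForm_tailEntries_eq y e l).1]
  simp only [h.eq_some_iff hl]
  by_cases he : C.dst e = C.dst l
  · rw [he, hl, Option.some_inj] at hl'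
    simp only [he, hd, ← hl', if_true, if_false, zero_add, sub_eq_add_neg, Sum.inl.injEq,
      Prod.mk.injEq, Fin.reduceEq, and_false]
  · have h1 : l' ≠ l := fun h1 => he ((h.eq_some_iff hl _).1 (h1 ▸ hl'))
    have h2 : e ≠ l := fun h2 => he (h2 ▸ rfl)
    simp [he, h1, h2]

open Classical in
theorem IsLead.rowForm_edgeList_conj (h : C.IsLead lead) {l : Fin m}
    (hl : lead (C.dst l) = some l) (hd : C.label (C.dst l) = .conj) :
    rowForm (edgeList C lead) (.inl (l, 1)) y
      = y l - ∑ e, if C.src e = C.dst l then y e else 0 := by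
  have hy : y l = ∑ e, if e = l then y e else 0 := by simp
  rw [rowForm_edgeList, hy, ← Finset.sum_sub_distrib]
  refine Finset.sum_congr rfl fun e _ => ?_
  obtain ⟨l', hl'⟩ := h.exists_eq e
  rw [(rowForm_headEntries y e l hl').1, (rowForm_tailEntries_eq y e l).1]
  simp only [h.eq_some_iff hl]
  by_cases he : C.dst e = C.dst l
  · rw [he, hl, Option.some_inj] at hl'
    simp only [he, hd, ← hl']
    by_cases h2 : e = l
    · simp [h2]
      ring
    · simp [h2]
  · have h1 : l' ≠ l := fun h1 => he ((h.eq_some_iff hl _).1 (h1 ▸ hl'))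
    have h2 : e ≠ l := fun h2 => he (h2 ▸ rfl)
    simp [h1, h2]

open Classical in
-- As `l₀` is not the leading edge of any gate, no outflow is written into this row; only `l₀`, as
-- an edge into its head, can contribute.
theorem IsLead.rowForm_edgeList_of_ne (h : C.IsLead lead) {l l₀ : Fin m}
    (hl : lead (C.dst l₀) = some l) (hne : l₀ ≠ l) :
    rowForm (edgeList C lead) (.inl (l₀, 1)) y
      = if C.label (C.dst l₀) = .disj then 0 else y l₀ - y l := by
  have h0 : ∀ g, lead g ≠ some l₀ := fun g hg => by
    rw [h.dst_eq _ _ hg, hg, Option.some_inj] at hl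
    exact hne hl
  rw [rowForm_edgeList, Finset.sum_eq_single l₀]
  · rw [(rowForm_headEntries y l₀ l₀ hl).1, (rowForm_tailEntries_eq y l₀ l₀).1]
    simp [h0, hne.symm, hne]
  · intro e _ he
    obtain ⟨l', hl'⟩ := h.exists_eq e
    rw [(rowForm_headEntries y e l₀ hl').1, (rowForm_tailEntries_eq y e l₀).1]
    have : l' ≠ l₀ := fun h1 => h0 _ (h1 ▸ hl')
    simp [h0, this, he]
  · simp

end Pairs

open Classical in
theorem sum_outflow_literal (C : NNF (Fin k) (Fin n) (Fin m)) (y : Fin m → ℝ) (v : Fin k) :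
    ∑ g with C.label g = .lit v true, C.outflow y g
      = (∑ e, if C.label (C.src e) = .lit v true then y e else 0)
        + if C.label C.out = .lit v true then 1 else 0 := by
  have := C.sum_outflow_mul y fun g => if C.label g = .lit v true then 1 else 0
  simpa only [mul_ite, mul_one, mul_zero, ← Finset.sum_filter] using this

theorem outflow_eq_sum_ite (C : NNF (Fin k) (Fin n) (Fin m)) (y : Fin m → ℝ) (g : Fin n) :
    C.outflow y g = (∑ e, if C.src e = g then y e else 0) + if C.out = g then 1 else 0 := by
  unfold outflow
  rw [Finset.sum_filter]
  simp only [eq_comm (a := g)]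
  congr!

open Classical in
theorem isFlow_iff_sum_ite (x : Fin k → ℝ) (y : Fin m → ℝ) : C.IsFlow x y ↔
    (∀ e, 0 ≤ y e) ∧
    (∀ g, C.label g = .disj → (∑ e, if C.dst e = g then y e else 0) = C.outflow y g) ∧
    (∀ e, C.label (C.dst e) = .conj → y e = C.outflow y (C.dst e)) ∧
    (∀ g, C.label g = .const false → C.outflow y g = 0) ∧
    ∀ v, x v = (∑ e, if C.label (C.src e) = .lit v true then y e else 0)
        + if C.label C.out = .lit v true then 1 else 0 := by
  simp only [← sum_outflow_literal]
  constructor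
  · refine fun h => ⟨h.nonneg, fun g hg => ?_, h.conj, h.zero, h.proj⟩
    rw [← h.disj g hg, Finset.sum_filter]
    congr!
  · rintro ⟨h1, h2, h3, h4, h5⟩
    refine ⟨h1, fun g hg => ?_, h3, h4, h5⟩
    rw [← h2 g hg, Finset.sum_filter]
    congr!

theorem forall_sysRow {p : SysRow k m → Prop} : (∀ r, p r) ↔
    (∀ e, p (.inl (e, 0)) ∧ p (.inl (e, 1)) ∧ p (.inl (e, 2)) ∧ p (.inl (e, 3))) ∧
    (∀ v, p (.inr (.inl (v, 0))) ∧ p (.inr (.inl (v, 1)))) ∧ p (.inr (.inr 0)) := by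
  constructor
  · exact fun h => ⟨fun e => ⟨h _, h _, h _, h _⟩, fun v => ⟨h _, h _⟩, h _⟩
  · rintro ⟨h1, h2, h3⟩ (⟨e, i⟩ | ⟨v, i⟩ | i)
    · fin_cases i
      exacts [(h1 e).1, (h1 e).2.1, (h1 e).2.2.1, (h1 e).2.2.2]
    · fin_cases i
      exacts [(h2 v).1, (h2 v).2]
    · fin_cases i
      exact h3

/-- The system given by the lists of entries is the flow system. -/
theorem IsLead.forall_rowForm_le_iff (h : C.IsLead lead) (x : Fin k → ℝ) (y : Fin m → ℝ) :
    (∀ r, rowForm (varList k m) r x + rowForm (edgeList C lead) r y ≤ sysRhs C lead r)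
      ↔ C.IsFlow x y := by
  rw [forall_sysRow]
  simp only [rowForm_varList_edge, rowForm_varList_out, rowForm_edgeList_out, zero_add,
    rowForm_edgeList_nonneg, h.rowForm_edgeList_two, h.rowForm_edgeList_zero,
    (rowForm_varList _ x).1, (rowForm_varList _ x).2, (h.rowForm_edgeList_var y _).1,
    (h.rowForm_edgeList_var y _).2, sysRhs]
  constructor
  · rintro ⟨h1, h2, h3⟩
    have hy : ∀ e, 0 ≤ y e := fun e => by linarith [(h1 e).1]
    have heq : ∀ e, rowForm (edgeList C lead) (.inl (e, 1)) y
        = if lead C.out = some e then 1 else 0 := fun e => by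
      have h4 := (h1 e).2.1
      have h5 := (h1 e).2.2.1
      split_ifs at h4 h5 ⊢ <;> linarith
    rw [isFlow_iff_sum_ite]
    refine ⟨hy, fun g hg => ?_, fun e he => ?_, fun g hg => ?_, fun v => ?_⟩
    · obtain ⟨e, rfl⟩ := C.exists_dst_eq (g := g) (by rw [hg]; exact id)
      obtain ⟨l, hl⟩ := h.exists_eq e
      have hd := h.dst_eq _ _ hl
      rw [← hd] at hl hg ⊢
      have := heq l
      rw [h.rowForm_edgeList_disj y hl hg] at this
      simp only [h.eq_some_iff hl] at this
      rw [outflow_eq_sum_ite]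
      linarith
    · obtain ⟨l, hl⟩ := h.exists_eq e
      have hd := h.dst_eq _ _ hl
      -- The equation holds at the leading edge; any other edge into the gate equals it by its own
      -- rows, whose right hand side is zero.
      have hyl : y l = C.outflow y (C.dst e) := by
        rw [← hd] at hl he ⊢
        have := heq l
        rw [h.rowForm_edgeList_conj y hl he] at this
        simp only [h.eq_some_iff hl] at this
        rw [outflow_eq_sum_ite]
        linarith
      by_cases hel : e = l
      · rwa [← hel] at hyl
      · have := heq e
        rw [h.rowForm_edgeList_of_ne y hl hel, he, if_neg (by simp), if_neg] at this
        · linarith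
        · intro ho
          rw [h.dst_eq _ _ ho, ho, Option.some_inj] at hl
          exact hel hl
    · have ho : C.out ≠ g := by
        rintro rfl
        rw [if_pos hg] at h3
        linarith
      rw [outflow_eq_sum_ite, if_neg ho, add_zero]
      refine Finset.sum_eq_zero fun e _ => ?_
      split_ifs with he
      · have := (h1 e).2.2.2
        rw [he, if_pos hg] at this
        exact le_antisymm this (hy e)
      · rfl
    · have h4 := (h2 v).1
      have h5 := (h2 v).2
      split_ifs at h4 h5 ⊢ <;> linarith
  · intro hf
    obtain ⟨h1, h2, h3, h4, h5⟩ := (isFlow_iff_sum_ite x y).1 hf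
    have heq : ∀ e, rowForm (edgeList C lead) (.inl (e, 1)) y
        = if lead C.out = some e then 1 else 0 := fun e => by
      obtain ⟨l, hl⟩ := h.exists_eq e
      by_cases hel : e = l
      · subst hel
        simp only [h.eq_some_iff hl]
        rcases C.label_dst e with hd | hd
        · rw [h.rowForm_edgeList_conj y hl hd, h3 e hd, outflow_eq_sum_ite, add_sub_cancel_left]
        · rw [h.rowForm_edgeList_disj y hl hd, h2 _ hd, outflow_eq_sum_ite, add_sub_cancel_left]
      · rw [h.rowForm_edgeList_of_ne y hl hel, if_neg (c := lead C.out = some e)]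
        · rcases C.label_dst e with hd | hd
          · rw [if_neg (by simp [hd]), h3 e hd, h3 l (h.dst_eq _ _ hl ▸ hd),
              h.dst_eq _ _ hl, sub_self]
          · rw [if_pos hd]
        · intro ho
          rw [h.dst_eq _ _ ho, ho, Option.some_inj] at hl
          exact hel hl
    refine ⟨fun e => ⟨by linarith [h1 e], (heq e).le, ?_, ?_⟩, fun v => ?_, ?_⟩
    · rw [heq e]
      split_ifs <;> simp
    · split_ifs with hc
      · exact (le_outflow_src h1 e).trans (h4 _ hc).le
      · exact le_rfl
    · have := h5 v
      constructor <;> split_ifs at this ⊢ <;> linarith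
    · split_ifs with hc
      · have := one_le_outflow_out (C := C) h1
        rw [h4 _ hc] at this
        norm_num at this
      · exact le_rfl

end System

end NNF

/-! ### Reasoning about programs -/

/-- Every run of `p` from a memory in `P` ends after at most `c` steps in a memory in `Q`. -/
def RamTriple (P : RamMem → Prop) (p : RamProg) (c : ℕ) (Q : RamMem → Prop) : Prop :=
  ∀ s, P s → ∃ s' t, RamExec p s s' t ∧ t ≤ c ∧ Q s'

namespace RamTriple

variable {P P' Q Q' R : RamMem → Prop} {p q : RamProg} {b : RamTest} {c d : ℕ}

theorem mono (h : RamTriple P p c Q) (hP : ∀ s, P' s → P s) (hcd : c ≤ d) (hQ : ∀ s, Q s → Q' s) :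
    RamTriple P' p d Q' := fun s hs => by
  obtain ⟨s', t, he, ht, hq⟩ := h s (hP s hs)
  exact ⟨s', t, he, ht.trans hcd, hQ s' hq⟩

theorem seq (h : RamTriple P p c Q) (h' : RamTriple Q q d R) :
    RamTriple P (.seq p q) (c + d) R := fun s hs => by
  obtain ⟨s', t, he, ht, hq⟩ := h s hs
  obtain ⟨s'', t', he', ht', hr⟩ := h' s' hq
  exact ⟨s'', t + t', .seq he he', by omega, hr⟩

/-- The outcome of the test is the same for all memories in `P`, so a test of registers can be read
as a case distinction on the circuit. -/
theorem ite {B : Prop} (hb : ∀ s, P s → (b.Holds s ↔ B)) (hp : B → RamTriple P p c Q)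
    (hq : ¬ B → RamTriple P q c Q) : RamTriple P (.ite b p q) (c + 1) Q := fun s hs => by
  by_cases h : B
  · obtain ⟨s', t, he, ht, hr⟩ := hp h s hs
    exact ⟨s', t + 1, .iteTrue ((hb s hs).2 h) he, by omega, hr⟩
  · obtain ⟨s', t, he, ht, hr⟩ := hq h s hs
    exact ⟨s', t + 1, .iteFalse (fun hh => h ((hb s hs).1 hh)) he, by omega, hr⟩

/-- Each round pays for the body and one test; the failing test at the end costs one more. -/
theorem loop {I : ℕ → RamMem → Prop} {N : ℕ} (hb : ∀ j s, I j s → (b.Holds s ↔ j < N))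
    (hp : ∀ j < N, RamTriple (I j) p c (I (j + 1))) :
    RamTriple (I 0) (.loop b p) (N * (c + 1) + 1) (I N) := by
  have key : ∀ d j, j + d = N → RamTriple (I j) (.loop b p) (d * (c + 1) + 1) (I N) := by
    intro d
    induction d with
    | zero =>
      rintro j rfl s hs
      exact ⟨s, 1, .loopFalse fun h => by have := (hb _ s hs).1 h; omega, by omega, hs⟩
    | succ d ih =>
      intro j hj s hs
      obtain ⟨s', t, he, ht, hI⟩ := hp j (by omega) s hs
      obtain ⟨s'', t', he', ht', hI'⟩ := ih (j + 1) (by omega) s' hI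
      refine ⟨s'', t + t' + 1, .loopTrue ((hb j s hs).2 (by omega)) he he', ?_, hI'⟩
      rw [Nat.succ_mul]
      omega
  exact key N 0 (Nat.zero_add N)

end RamTriple

namespace RamProg

/-- The memory after a program without tests and loops. -/
def run : RamProg → RamMem → RamMem
  | .const r c, s => s.setReg r c
  | .copy r r', s => s.setReg r (s.reg r')
  | .succ r, s => s.setReg r (s.reg r + 1)
  | .pred r, s => s.setReg r (s.reg r - 1)
  | .load r a i, s => s.setReg r (s.arr a (s.reg i))
  | .store a i r, s => s.setArr a (s.reg i) (s.reg r)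
  | .seq p q, s => q.run (p.run s)
  | _, s => s

/-- The program has no tests and loops. -/
def IsStraight : RamProg → Prop
  | .seq p q => p.IsStraight ∧ q.IsStraight
  | .ite _ _ _ => False
  | .loop _ _ => False
  | _ => True

/-- The number of elementary instructions of a program without tests and loops. -/
def cost : RamProg → ℕ
  | .seq p q => p.cost + q.cost
  | _ => 1

theorem IsStraight.ramExec {p : RamProg} (hp : p.IsStraight) (s : RamMem) :
    RamExec p s (p.run s) p.cost := by
  induction p generalizing s with
  | const r c => exact .const r c s
  | copy r r' => exact .copy r r' s
  | succ r => exact .succ r s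
  | pred r => exact .pred r s
  | load r a i => exact .load r a i s
  | store a i r => exact .store a i r s
  | skip => exact .skip s
  | seq p q ihp ihq => exact .seq (ihp hp.1 s) (ihq hp.2 _)
  | ite b p q => exact hp.elim
  | loop b p => exact hp.elim

theorem IsStraight.ramTriple {p : RamProg} (hp : p.IsStraight) {P Q : RamMem → Prop}
    (h : ∀ s, P s → Q (p.run s)) : RamTriple P p p.cost Q :=
  fun s hs => ⟨p.run s, p.cost, hp.ramExec s, le_rfl, h s hs⟩

end RamProg

namespace RamMem

@[simp] theorem setReg_reg (s : RamMem) (r c x : ℕ) :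
    (s.setReg r c).reg x = if x = r then c else s.reg x := by
  simp [setReg, Function.update_apply]

@[simp] theorem setReg_arr (s : RamMem) (r c : ℕ) : (s.setReg r c).arr = s.arr := rfl

@[simp] theorem setArr_reg (s : RamMem) (a i c : ℕ) : (s.setArr a i c).reg = s.reg := rfl

@[simp] theorem setArr_arr (s : RamMem) (a i c x : ℕ) :
    (s.setArr a i c).arr x = if x = a then Function.update (s.arr a) i c else s.arr x := by
  by_cases h : x = a
  · subst h
    simp [setArr]
  · simp [setArr, h]

/-- Two memories agree outside the registers `X` and the arrays `Y`. -/
def Agree (X Y : List ℕ) (s s₀ : RamMem) : Prop :=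
  (∀ x, x ∉ X → s.reg x = s₀.reg x) ∧ ∀ a, a ∉ Y → s.arr a = s₀.arr a

theorem Agree.refl (X Y : List ℕ) (s : RamMem) : Agree X Y s s := ⟨fun _ _ => rfl, fun _ _ => rfl⟩

theorem Agree.trans {X Y : List ℕ} {s s' s'' : RamMem} (h : Agree X Y s s')
    (h' : Agree X Y s' s'') : Agree X Y s s'' :=
  ⟨fun x hx => (h.1 x hx).trans (h'.1 x hx), fun a ha => (h.2 a ha).trans (h'.2 a ha)⟩

theorem Agree.mono {X Y X' Y' : List ℕ} {s s' : RamMem} (h : Agree X Y s s')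
    (hX : X ⊆ X') (hY : Y ⊆ Y') : Agree X' Y' s s' :=
  ⟨fun x hx => h.1 x fun hh => hx (hX hh), fun a ha => h.2 a fun hh => ha (hY hh)⟩

/-- The arrays `a`, `a + 1`, `a + 2` contain the list `L`, and the register `c` its length. -/
def HoldsList (a c : ℕ) (L : List (ℕ × ℕ × ℕ)) (s : RamMem) : Prop :=
  s.reg c = L.length ∧
    ∀ t (h : t < L.length), (s.arr a t, s.arr (a + 1) t, s.arr (a + 2) t) = L[t]

theorem HoldsList.congr {a c : ℕ} {L : List (ℕ × ℕ × ℕ)} {s s' : RamMem} (h : HoldsList a c L s)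
    (hc : s'.reg c = s.reg c) (h0 : s'.arr a = s.arr a) (h1 : s'.arr (a + 1) = s.arr (a + 1))
    (h2 : s'.arr (a + 2) = s.arr (a + 2)) : HoldsList a c L s' := by
  refine ⟨hc.trans h.1, fun t ht => ?_⟩
  rw [h0, h1, h2]
  exact h.2 t ht

/-- The memory is `s₀`, except that it contains the list `L` in the arrays `a`, `a + 1`, `a + 2`
with its length in the register `c`. -/
def Extends (a c : ℕ) (s₀ : RamMem) (L : List (ℕ × ℕ × ℕ)) (s : RamMem) : Prop :=
  Agree [c] [a, a + 1, a + 2] s s₀ ∧ HoldsList a c L s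

end RamMem

namespace RamProg

open RamMem

/-- Append an entry, whose components are in the registers `r`, `q`, `v`, to the list in the arrays
`a`, `a + 1`, `a + 2`, with its length in the register `c`. -/
def emit (a c r q v : ℕ) : RamProg :=
  .seq (.store a c r) (.seq (.store (a + 1) c q) (.seq (.store (a + 2) c v) (.succ c)))

/-- Append the entry in the registers `r`, `q`, `v`, and then an entry with the number of the next
row and `w` instead of `v`. -/
def emitPair (a c r q v w : ℕ) : RamProg :=
  .seq (emit a c r q v) (.seq (.succ r) (.seq (emit a c r q w) (.pred r)))

theorem emit_triple {a c r q v : ℕ} (hr : r ≠ c) (hq : q ≠ c) (hv : v ≠ c) (s₀ : RamMem)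
    (L : List (ℕ × ℕ × ℕ)) :
    RamTriple (Extends a c s₀ L) (emit a c r q v) 4
      (Extends a c s₀ (L ++ [(s₀.reg r, s₀.reg q, s₀.reg v)])) := by
  have hst : (emit a c r q v).IsStraight := by simp [emit, IsStraight]
  refine (hst.ramTriple fun s hs => ?_).mono (fun _ h => h) le_rfl fun _ h => h
  obtain ⟨⟨hreg, harr⟩, hlen, hL⟩ := hs
  refine ⟨⟨fun x hx => ?_, fun b hb => ?_⟩, ?_, fun t ht => ?_⟩
  · have hx' : x ≠ c := by simpa using hx
    simp [emit, run, hx', hreg x hx]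
  · simp only [List.mem_cons, List.not_mem_nil, or_false, not_or] at hb
    simp [emit, run, hb, harr b (by simp [hb])]
  · simp [emit, run, hlen]
  · rw [List.length_append, List.length_singleton] at ht
    have e1 := hreg r (by simpa using hr)
    have e2 := hreg q (by simpa using hq)
    have e3 := hreg v (by simpa using hv)
    by_cases h : t < L.length
    · rw [List.getElem_append_left h, ← hL t h]
      simp [emit, run, hlen, Function.update_of_ne h.ne]
    · obtain rfl : t = L.length := by omega
      simp [emit, run, hlen, e1, e2, e3]

theorem emitPair_triple {a c r q v w : ℕ} (hr : r ≠ c) (hq : q ≠ c) (hv : v ≠ c) (hw : w ≠ c)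
    (hqr : q ≠ r) (hwr : w ≠ r) (s₀ : RamMem) (L : List (ℕ × ℕ × ℕ)) :
    RamTriple (Extends a c s₀ L) (emitPair a c r q v w) 10
      (Extends a c s₀ (L ++ [(s₀.reg r, s₀.reg q, s₀.reg v),
        (s₀.reg r + 1, s₀.reg q, s₀.reg w)])) := by
  have h1 := emit_triple (a := a) hr hq hv s₀ L
  -- For the second entry the reference memory has the row register advanced; restoring the register
  -- afterwards returns to `s₀`.
  have h2 : RamTriple (Extends a c s₀ (L ++ [(s₀.reg r, s₀.reg q, s₀.reg v)])) (.succ r) 1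
      (Extends a c (s₀.setReg r (s₀.reg r + 1)) (L ++ [(s₀.reg r, s₀.reg q, s₀.reg v)])) := by
    refine IsStraight.ramTriple (p := .succ r) trivial fun s hs => ⟨⟨fun x hx => ?_, fun b hb => hs.1.2 b hb⟩,
      hs.2.congr ?_ rfl rfl rfl⟩
    · have := hs.1.1 x hx
      by_cases h : x = r <;> simp_all [run]
    · simp [run, hr.symm]
  have h3 := emit_triple (a := a) hr hq hw (s₀.setReg r (s₀.reg r + 1))
    (L ++ [(s₀.reg r, s₀.reg q, s₀.reg v)])
  have h4 : RamTriple (Extends a c (s₀.setReg r (s₀.reg r + 1))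
      ((L ++ [(s₀.reg r, s₀.reg q, s₀.reg v)]) ++ [((s₀.setReg r (s₀.reg r + 1)).reg r,
        (s₀.setReg r (s₀.reg r + 1)).reg q, (s₀.setReg r (s₀.reg r + 1)).reg w)])) (.pred r) 1
      (Extends a c s₀ (L ++ [(s₀.reg r, s₀.reg q, s₀.reg v),
        (s₀.reg r + 1, s₀.reg q, s₀.reg w)])) := by
    refine IsStraight.ramTriple (p := .pred r) trivial fun s hs => ⟨⟨fun x hx => ?_, fun b hb => hs.1.2 b hb⟩, ?_⟩
    · have := hs.1.1 x hx
      by_cases h : x = r <;> simp_all [run]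
    · have h5 := hs.2
      simp only [setReg_reg, if_true, if_neg hqr, if_neg hwr, List.append_assoc,
        List.cons_append, List.nil_append] at h5
      exact h5.congr (by simp [run, hr.symm]) rfl rfl rfl
  exact (h1.seq (h2.seq (h3.seq h4))).mono (fun _ h => h) (by omega) fun _ h => h

end RamProg

/-! ### The program -/

namespace RamProg

open RamMem

/-- Load the constants `1`, `2`, `5`, `3` into the registers `9`, `10`, `11`, `12`. -/
def initConstants : RamProg :=
  .seq (.const 9 1) (.seq (.const 10 2) (.seq (.const 11 5) (.const 12 3)))

/-- Record the edge in register `7` as the leading edge of its head (array `13`) and the number of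
its first row (array `11`). -/
def leadStep : RamProg :=
  .seq (.store 11 7 4) (.seq (.load 14 3 7) (.seq (.store 13 14 7) (.seq (.succ 4) (.seq (.succ 4)
    (.seq (.succ 4) (.seq (.succ 4) (.succ 7)))))))

/-- Record the number of the first row of the variable in register `7` (array `12`). -/
def varStore : RamProg := .store 12 7 4

/-- Proceed to the next variable. -/
def varNext : RamProg := .seq (.succ 4) (.seq (.succ 4) (.succ 7))

/-- Write the coefficients of the variable in register `7`. -/
def varStep : RamProg := .seq varStore (.seq (emitPair 4 5 4 7 9 10) varNext)

/-- Load everything that concerns the edge in register `7`: its head (`14`) and tail (`15`), their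
kinds (`16`, `17`), their leading edges (`18`, `19`), the rows of the edge (`20`, `25`, `26`) and of
the leading edges (`21`, `22`), and the row of the variable of the tail (`24`). -/
def edgeLoads : RamProg :=
  .seq (.load 14 3 7) (.seq (.load 15 2 7) (.seq (.load 16 0 14) (.seq (.load 17 0 15)
  (.seq (.load 18 13 14) (.seq (.load 19 13 15) (.seq (.load 20 11 7) (.seq (.load 21 11 18)
  (.seq (.load 22 11 19) (.seq (.load 23 1 15) (.seq (.load 24 12 23) (.seq (.succ 21)
  (.seq (.succ 22) (.seq (.copy 25 20) (.seq (.succ 25) (.seq (.copy 26 25) (.seq (.succ 26)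
  (.succ 26)))))))))))))))))

/-- Write the coefficients of the edge as an edge into its head. -/
def edgeHead : RamProg :=
  .ite (.eq 16 11) (emitPair 7 6 21 7 9 10)
    (.seq (emitPair 7 6 25 7 9 10) (.ite (.eq 7 18) .skip (emitPair 7 6 25 18 10 9)))

/-- Write the coefficients of the edge as an edge out of its tail. -/
def edgeTail : RamProg :=
  .ite (.lt 12 17) (emitPair 7 6 22 7 10 9)
    (.ite (.eq 17 12) (emitPair 7 6 24 7 10 9) (.ite (.eq 17 13) (emit 7 6 26 7 9) .skip))

/-- Write the coefficients that are caused by the edge in register `7`. -/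
def edgeStep : RamProg :=
  .seq edgeLoads (.seq (emit 7 6 20 7 10) (.seq edgeHead (.seq edgeTail (.succ 7))))

/-- Write the right hand side. -/
def writeRhs : RamProg :=
  .seq (.seq (.load 14 0 3) (.seq (.load 15 13 3) (.seq (.load 16 11 15) (.seq (.load 17 1 3)
    (.load 18 12 17)))))
  (.seq (.ite (.lt 12 14)
      (.seq (.succ 16) (.seq (.store 10 16 9) (.seq (.succ 16) (.store 10 16 10))))
      (.ite (.eq 14 12) (.seq (.store 10 18 9) (.seq (.succ 18) (.store 10 18 10)))
        (.ite (.eq 14 13) (.store 10 4 10) .skip)))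
    (.succ 4))

/-- The program that computes the system. -/
def systemProg : RamProg :=
  .seq initConstants (.seq (.loop (.lt 7 2) leadStep) (.seq (.const 7 0)
    (.seq (.loop (.lt 7 0) varStep) (.seq (.const 7 0) (.seq (.loop (.lt 7 2) edgeStep) writeRhs)))))

end RamProg

/-! ### Invariants and cost of the three loops -/

namespace NNF

open RamMem RamProg

variable {k n m : ℕ} {C : NNF (Fin k) (Fin n) (Fin m)} {lead : Fin n → Option (Fin m)}

theorem tabulate_apply {N : ℕ} (f : Fin N → ℕ) (i : Fin N) : tabulate f i = f i := by
  simp [tabulate]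

/-- The memory contains the circuit and the constants of the program, and the right hand side has
not been written yet. -/
structure InputMem (C : NNF (Fin k) (Fin n) (Fin m)) (s : RamMem) : Prop where
  reg0 : s.reg 0 = k
  reg2 : s.reg 2 = m
  reg3 : s.reg 3 = C.out
  reg9 : s.reg 9 = 1
  reg10 : s.reg 10 = 2
  reg11 : s.reg 11 = 5
  reg12 : s.reg 12 = 3
  reg13 : s.reg 13 = 0
  kind : ∀ g : Fin n, s.arr 0 g = (C.label g).kind
  varIdx : ∀ g : Fin n, s.arr 1 g = (C.label g).varIdx
  src : ∀ e : Fin m, s.arr 2 e = C.src e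
  dst : ∀ e : Fin m, s.arr 3 e = C.dst e
  rhs : ∀ i, s.arr 10 i = 0

theorem InputMem.congr {X Y : List ℕ} {s s' : RamMem} (h : C.InputMem s) (hs : Agree X Y s' s)
    (hX : ∀ x ∈ [0, 2, 3, 9, 10, 11, 12, 13], x ∉ X) (hY : ∀ a ∈ [0, 1, 2, 3, 10], a ∉ Y) :
    C.InputMem s' := by
  simp only [List.mem_cons, List.not_mem_nil, or_false, forall_eq_or_imp, forall_eq] at hX hY
  obtain ⟨x0, x2, x3, x9, x10, x11, x12, x13⟩ := hX
  obtain ⟨y0, y1, y2, y3, y10⟩ := hY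
  constructor
  · rw [hs.1 _ x0, h.reg0]
  · rw [hs.1 _ x2, h.reg2]
  · rw [hs.1 _ x3, h.reg3]
  · rw [hs.1 _ x9, h.reg9]
  · rw [hs.1 _ x10, h.reg10]
  · rw [hs.1 _ x11, h.reg11]
  · rw [hs.1 _ x12, h.reg12]
  · rw [hs.1 _ x13, h.reg13]
  · rw [hs.2 _ y0]; exact h.kind
  · rw [hs.2 _ y1]; exact h.varIdx
  · rw [hs.2 _ y2]; exact h.src
  · rw [hs.2 _ y3]; exact h.dst
  · rw [hs.2 _ y10]; exact h.rhs

/-- The invariant of the first loop. -/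
structure LeadInv (C : NNF (Fin k) (Fin n) (Fin m)) (j : ℕ) (s : RamMem) : Prop where
  input : C.InputMem s
  reg5 : s.reg 5 = 0
  reg6 : s.reg 6 = 0
  reg4 : s.reg 4 = 4 * j
  reg7 : s.reg 7 = j
  row : ∀ i < j, s.arr 11 i = 4 * i
  -- Later edges overwrite earlier ones with the same head; which edge ends up leading does not
  -- matter.
  lead : ∀ e : Fin m, (e : ℕ) < j → ∃ e' : Fin m, C.dst e' = C.dst e ∧ s.arr 13 (C.dst e) = e'

theorem initConstants_triple :
    RamTriple (· = C.encode) initConstants 4 (C.LeadInv 0) := by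
  have hst : initConstants.IsStraight := by simp [initConstants, IsStraight]
  refine (hst.ramTriple ?_).mono (fun _ h => h) le_rfl fun _ h => h
  rintro _ rfl
  refine ⟨⟨?_, ?_, ?_, ?_, ?_, ?_, ?_, ?_, ?_, ?_, ?_, ?_, ?_⟩, ?_, ?_, ?_, ?_, ?_, ?_⟩ <;>
    simp [initConstants, run, encode, tabulate_apply]

theorem leadStep_triple (j : ℕ) (hj : j < m) :
    RamTriple (C.LeadInv j) leadStep 8 (C.LeadInv (j + 1)) := by
  have hst : leadStep.IsStraight := by simp [leadStep, IsStraight]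
  refine (hst.ramTriple ?_).mono (fun _ h => h) le_rfl fun _ h => h
  intro s hs
  have hag : Agree [4, 7, 14] [11, 13] (leadStep.run s) s := by
    constructor
    · intro x hx
      simp only [List.mem_cons, List.not_mem_nil, or_false, not_or] at hx
      simp [leadStep, run, hx]
    · intro x hx
      simp only [List.mem_cons, List.not_mem_nil, or_false, not_or] at hx
      simp [leadStep, run, hx]
  have hd : s.arr 3 j = C.dst ⟨j, hj⟩ := hs.input.dst ⟨j, hj⟩
  refine ⟨hs.input.congr hag (by simp) (by simp), (hag.1 _ (by simp)).trans hs.reg5,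
    (hag.1 _ (by simp)).trans hs.reg6, ?_, ?_, fun i hi => ?_, fun e he => ?_⟩
  · simp [leadStep, run, hs.reg4]
    ring
  · simp [leadStep, run, hs.reg7]
  · have : (leadStep.run s).arr 11 = Function.update (s.arr 11) j (4 * j) := by
      simp [leadStep, run, hs.reg7, hs.reg4]
    rw [this, Function.update_apply]
    split_ifs with h
    · rw [h]
    · exact hs.row i (by omega)
  · have : (leadStep.run s).arr 13 = Function.update (s.arr 13) (C.dst ⟨j, hj⟩) j := by
      simp [leadStep, run, hs.reg7, hd]
    rw [this, Function.update_apply]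
    split_ifs with h
    · exact ⟨⟨j, hj⟩, (Fin.ext h).symm, rfl⟩
    · refine hs.lead e ?_
      have : (e : ℕ) ≠ j := fun hej => h (by subst hej; rfl)
      omega

theorem leadLoop_triple :
    RamTriple (C.LeadInv 0) (.loop (.lt 7 2) leadStep) (m * 9 + 1) (C.LeadInv m) := by
  refine RamTriple.loop (c := 8) (fun j s hs => ?_) leadStep_triple
  rw [RamTest.Holds, hs.reg7, hs.input.reg2]

/-- The memory after the first loop. -/
structure LeadMem (C : NNF (Fin k) (Fin n) (Fin m)) (lead : Fin n → Option (Fin m)) (s : RamMem) :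
    Prop where
  input : C.InputMem s
  row : ∀ e : Fin m, s.arr 11 e = 4 * e
  lead : ∀ g l, lead g = some l → s.arr 13 g = l

theorem LeadMem.congr {X Y : List ℕ} {s s' : RamMem} (h : C.LeadMem lead s) (hs : Agree X Y s' s)
    (hX : ∀ x ∈ [0, 2, 3, 9, 10, 11, 12, 13], x ∉ X)
    (hY : ∀ a ∈ [0, 1, 2, 3, 10, 11, 13], a ∉ Y) : C.LeadMem lead s' := by
  simp only [List.mem_cons, List.not_mem_nil, or_false, forall_eq_or_imp, forall_eq] at hY
  obtain ⟨y0, y1, y2, y3, y10, y11, y13⟩ := hY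
  refine ⟨h.input.congr hs hX (by simp [*]), ?_, ?_⟩
  · rw [hs.2 _ y11]; exact h.row
  · rw [hs.2 _ y13]; exact h.lead

open Classical in
-- The leading edges are read off the memory after the loop. The cells of leaves carry no
-- information, so leaves get `none` and the program recognises them by their kind.
theorem LeadInv.exists_lead {s : RamMem} (h : C.LeadInv m s) :
    ∃ lead, C.IsLead lead ∧ C.LeadMem lead s := by
  have hex : ∀ e : Fin m, ∃ e' : Fin m, C.dst e' = C.dst e ∧ s.arr 13 (C.dst e) = e' :=
    fun e => h.lead e e.2
  have hlt : ∀ e : Fin m, s.arr 13 (C.dst e) < m := fun e => by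
    obtain ⟨e', -, h'⟩ := hex e
    rw [h']
    exact e'.2
  have hg : ∀ g : Fin n, ∃ o : Option (Fin m), (∀ l, o = some l → C.dst l = g ∧ s.arr 13 g = l) ∧
      ((∃ e, C.dst e = g) → ∃ l, o = some l) := by
    intro g
    by_cases hg : ∃ e, C.dst e = g
    · obtain ⟨e, rfl⟩ := hg
      obtain ⟨e', h1, h2⟩ := hex e
      refine ⟨some e', fun l hl => ?_, fun _ => ⟨e', rfl⟩⟩
      rw [Option.some_inj] at hl
      exact hl ▸ ⟨h1, h2⟩
    · exact ⟨none, by simp, fun hh => absurd hh hg⟩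
  choose lead h1 h2 using hg
  exact ⟨lead, ⟨fun g l hl => (h1 g l hl).1, fun e => h2 _ ⟨e, rfl⟩⟩,
    h.input, fun e => h.row e e.2, fun g l hl => (h1 g l hl).2⟩

/-- The first `j` blocks of a list of entries, with numbered rows. -/
def codePrefix {N c : ℕ} (f : Fin N → List (SysRow k m × Fin c × Bool)) (j : ℕ) :
    List (ℕ × ℕ × ℕ) :=
  (((List.finRange N).take j).flatMap f).map (entryCode (rowEquiv k m))

theorem codePrefix_succ {N c : ℕ} (f : Fin N → List (SysRow k m × Fin c × Bool)) {j : ℕ}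
    (hj : j < N) :
    codePrefix f (j + 1) = codePrefix f j ++ (f ⟨j, hj⟩).map (entryCode (rowEquiv k m)) := by
  unfold codePrefix
  rw [List.take_succ_eq_append_getElem (by simpa using hj)]
  simp

theorem codePrefix_self {N c : ℕ} (f : Fin N → List (SysRow k m × Fin c × Bool)) :
    codePrefix f N = ((List.finRange N).flatMap f).map (entryCode (rowEquiv k m)) := by
  unfold codePrefix
  rw [List.take_of_length_le (by simp)]

theorem map_entryCode_eqPair (l e : Fin m) (b : Bool) :
    (eqPair k l e b).map (entryCode (rowEquiv k m))
      = [(4 * (l : ℕ) + 1, (e : ℕ), signCode b), (4 * (l : ℕ) + 1 + 1, (e : ℕ), signCode !b)] := by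
  simp [eqPair, entryCode, rowEquiv_edge]

theorem map_entryCode_varPair {c : ℕ} (v : Fin k) (q : Fin c) (b : Bool) :
    (varPair m v q b).map (entryCode (rowEquiv k m))
      = [(4 * m + 2 * v, (q : ℕ), signCode b), (4 * m + 2 * v + 1, (q : ℕ), signCode !b)] := by
  simp [varPair, entryCode, rowEquiv_var]

/-- The invariant of the second loop. -/
structure VarInv (C : NNF (Fin k) (Fin n) (Fin m)) (lead : Fin n → Option (Fin m)) (j : ℕ)
    (s : RamMem) : Prop where
  mem : C.LeadMem lead s
  reg6 : s.reg 6 = 0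
  reg4 : s.reg 4 = 4 * m + 2 * j
  reg7 : s.reg 7 = j
  row : ∀ i < j, s.arr 12 i = 4 * m + 2 * i
  list : HoldsList 4 5 (codePrefix (k := k) (m := m) (fun v => varPair m v v true) j) s

theorem varStep_triple (j : ℕ) (hj : j < k) :
    RamTriple (C.VarInv lead j) varStep 14 (C.VarInv lead (j + 1)) := by
  intro s hs
  let s₀ := varStore.run s
  let L := codePrefix (k := k) (m := m) (fun v => varPair m v v true) j
  have h0 : RamTriple (· = s) varStore 1 (Extends 4 5 s₀ L) := by
    refine IsStraight.ramTriple (p := .store 12 7 4) trivial ?_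
    rintro _ rfl
    exact ⟨Agree.refl _ _ _, hs.list.congr (by simp [run]) (by simp [run]) (by simp [run])
      (by simp [run])⟩
  have h1 := emitPair_triple (a := 4) (c := 5) (r := 4) (q := 7) (v := 9) (w := 10) (by simp)
    (by simp) (by simp) (by simp) (by simp) (by simp) s₀ L
  have hag0 : Agree [] [12] s₀ s := by
    refine ⟨fun x _ => by simp [s₀, varStore, run], fun x hx => ?_⟩
    simp only [List.mem_cons, List.not_mem_nil, or_false] at hx
    simp [s₀, varStore, run, hx]
  have hL : L ++ [(s₀.reg 4, s₀.reg 7, s₀.reg 9), (s₀.reg 4 + 1, s₀.reg 7, s₀.reg 10)]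
      = codePrefix (k := k) (m := m) (fun v => varPair m v v true) (j + 1) := by
    rw [codePrefix_succ _ hj, map_entryCode_varPair]
    simp [s₀, varStore, run, hs.reg4, hs.reg7, hs.mem.input.reg9, hs.mem.input.reg10, signCode, L]
  have h2 : RamTriple (Extends 4 5 s₀ (L ++ [(s₀.reg 4, s₀.reg 7, s₀.reg 9),
      (s₀.reg 4 + 1, s₀.reg 7, s₀.reg 10)])) varNext 3 (C.VarInv lead (j + 1)) := by
    have hst : varNext.IsStraight := by simp [varNext, IsStraight]
    refine (hst.ramTriple ?_).mono (fun _ h => h) le_rfl fun _ h => h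
    intro s' hs'
    rw [hL] at hs'
    have hag : Agree [4, 5, 7] [4, 5, 6, 12] (varNext.run s') s := by
      refine Agree.trans (s' := s') ?_ ((hs'.1.mono (by simp) (by simp)).trans
        (hag0.mono (by simp) (by simp)))
      refine ⟨fun x hx => ?_, fun x hx => rfl⟩
      simp only [List.mem_cons, List.not_mem_nil, or_false, not_or] at hx
      simp [varNext, run, hx]
    have e4 : s'.reg 4 = 4 * m + 2 * j :=
      (hs'.1.1 4 (by simp)).trans ((hag0.1 4 (by simp)).trans hs.reg4)
    have e7 : s'.reg 7 = j := (hs'.1.1 7 (by simp)).trans ((hag0.1 7 (by simp)).trans hs.reg7)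
    have e12 : (varNext.run s').arr 12 = Function.update (s.arr 12) j (4 * m + 2 * j) := by
      have : (varNext.run s').arr 12 = s₀.arr 12 := hs'.1.2 12 (by simp)
      rw [this]
      simp [s₀, varStore, run, hs.reg7, hs.reg4]
    refine ⟨hs.mem.congr hag (by simp) (by simp), (hag.1 6 (by simp)).trans hs.reg6, ?_, ?_,
      fun i hi => ?_, ?_⟩
    · simp [varNext, run, e4]
      ring
    · simp [varNext, run, e7]
    · rw [e12, Function.update_apply]
      split_ifs with h
      · rw [h]
      · exact hs.row i (by omega)
    · exact hs'.2.congr (by simp [varNext, run]) rfl rfl rfl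
  exact (h0.seq (h1.seq h2)) s rfl

theorem varLoop_triple :
    RamTriple (C.VarInv lead 0) (.loop (.lt 7 0) varStep) (k * 15 + 1) (C.VarInv lead k) := by
  refine RamTriple.loop (c := 14) (fun j s hs => ?_) varStep_triple
  rw [RamTest.Holds, hs.reg7, hs.mem.input.reg0]

/-- The invariant of the third loop. -/
structure EdgeInv (C : NNF (Fin k) (Fin n) (Fin m)) (lead : Fin n → Option (Fin m)) (j : ℕ)
    (s : RamMem) : Prop where
  mem : C.LeadMem lead s
  reg4 : s.reg 4 = 4 * m + 2 * k
  reg7 : s.reg 7 = j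
  row : ∀ v : Fin k, s.arr 12 v = 4 * m + 2 * v
  varList : HoldsList 4 5 ((varList k m).map (entryCode (rowEquiv k m))) s
  edgeList : HoldsList 7 6 (codePrefix (edgeEntries C lead) j) s

/-- The memory in which the coefficients of the edge `e` are written. -/
structure EdgeMem (C : NNF (Fin k) (Fin n) (Fin m)) (lead : Fin n → Option (Fin m)) (e : Fin m)
    (s : RamMem) : Prop where
  input : C.InputMem s
  reg7 : s.reg 7 = e
  reg16 : s.reg 16 = (C.label (C.dst e)).kind
  reg17 : s.reg 17 = (C.label (C.src e)).kind
  reg18 : ∀ l, lead (C.dst e) = some l → s.reg 18 = l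
  reg20 : s.reg 20 = 4 * e
  reg21 : ∀ l, lead (C.dst e) = some l → s.reg 21 = 4 * l + 1
  -- If the tail is a leaf, the register contains a meaningless value that `edgeTail` does not use.
  reg22 : ∀ l, lead (C.src e) = some l → s.reg 22 = 4 * l + 1
  reg24 : ∀ v b, C.label (C.src e) = .lit v b → s.reg 24 = 4 * m + 2 * v
  reg25 : s.reg 25 = 4 * e + 1
  reg26 : s.reg 26 = 4 * e + 3

theorem agree_edgeLoads (s : RamMem) :
    Agree [14, 15, 16, 17, 18, 19, 20, 21, 22, 23, 24, 25, 26] [] (edgeLoads.run s) s := by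
  constructor
  · intro x hx
    simp only [List.mem_cons, List.not_mem_nil, or_false, not_or] at hx
    simp [edgeLoads, run, hx]
  · intro x hx
    simp [edgeLoads, run]

theorem EdgeInv.edgeMem {j : ℕ} (hj : j < m) {s : RamMem} (hs : C.EdgeInv lead j s) :
    C.EdgeMem lead ⟨j, hj⟩ (edgeLoads.run s) := by
  have hd : s.arr 3 j = C.dst ⟨j, hj⟩ := hs.mem.input.dst ⟨j, hj⟩
  have hsrc : s.arr 2 j = C.src ⟨j, hj⟩ := hs.mem.input.src ⟨j, hj⟩
  have hrow : s.arr 11 j = 4 * j := hs.mem.row ⟨j, hj⟩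
  refine ⟨hs.mem.input.congr (agree_edgeLoads s) (by simp) (by simp), ?_, ?_, ?_, fun l hl => ?_,
    ?_, fun l hl => ?_, fun l hl => ?_, fun v b hv => ?_, ?_, ?_⟩
  · simp [edgeLoads, run, hs.reg7]
  · simp [edgeLoads, run, hs.reg7, hd, hs.mem.input.kind]
  · simp [edgeLoads, run, hs.reg7, hsrc, hs.mem.input.kind]
  · simp [edgeLoads, run, hs.reg7, hd, hs.mem.lead _ _ hl]
  · simp [edgeLoads, run, hs.reg7, hrow]
  · simp [edgeLoads, run, hs.reg7, hd, hs.mem.lead _ _ hl, hs.mem.row]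
  · simp [edgeLoads, run, hs.reg7, hsrc, hs.mem.lead _ _ hl, hs.mem.row]
  · simp [edgeLoads, run, hs.reg7, hsrc, hs.mem.input.varIdx, hv, GateLabel.varIdx, hs.row]
  · simp [edgeLoads, run, hs.reg7, hrow]
  · simp [edgeLoads, run, hs.reg7, hrow]

theorem reg_eq_of_extends {a c x : ℕ} {s₀ s : RamMem} {L : List (ℕ × ℕ × ℕ)}
    (h : Extends a c s₀ L s) (hx : x ≠ c) : s.reg x = s₀.reg x :=
  h.1.1 x (by simpa using hx)

theorem skip_triple (P : RamMem → Prop) {c : ℕ} (hc : 1 ≤ c) : RamTriple P .skip c P :=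
  fun s hs => ⟨s, 1, .skip s, hc, hs⟩

theorem edgeHead_triple (h : C.IsLead lead) {e : Fin m} {s₀ : RamMem} (h₀ : C.EdgeMem lead e s₀)
    (L : List (ℕ × ℕ × ℕ)) :
    RamTriple (Extends 7 6 s₀ L) edgeHead 22
      (Extends 7 6 s₀ (L ++ (headEntries C lead e).map (entryCode (rowEquiv k m)))) := by
  obtain ⟨l, hl⟩ := h.exists_eq e
  have hi := h₀.input
  refine RamTriple.ite (B := C.label (C.dst e) = .disj) (c := 21) (fun s hs => ?_) (fun hB => ?_)
    fun hB => ?_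
  · rw [RamTest.Holds, reg_eq_of_extends hs (by simp), reg_eq_of_extends hs (by simp), h₀.reg16,
      hi.reg11]
    rcases C.label_dst e with hd | hd <;> simp [hd, GateLabel.kind]
  · refine (emitPair_triple (by simp) (by simp) (by simp) (by simp) (by simp) (by simp) s₀ L).mono
      (fun _ h => h) (by omega) fun s hs => ?_
    simpa [headEntries, hl, hB, map_entryCode_eqPair, h₀.reg21 l hl, h₀.reg7, hi.reg9, hi.reg10,
      signCode] using hs
  · refine ((emitPair_triple (by simp) (by simp) (by simp) (by simp) (by simp) (by simp) s₀ L).seq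
      (RamTriple.ite (B := e = l) (c := 10) (fun s hs => ?_) (fun hB' => ?_) fun hB' => ?_)).mono
      (fun _ h => h) le_rfl fun _ h => h
    · rw [RamTest.Holds, reg_eq_of_extends hs (by simp), reg_eq_of_extends hs (by simp), h₀.reg7,
        h₀.reg18 l hl, Fin.ext_iff]
    · refine (skip_triple _ (by omega)).mono (fun _ h => h) le_rfl fun s hs => ?_
      have hd : C.label (C.dst l) ≠ .disj := by rwa [← hB']
      rw [← hB'] at hl
      simpa [headEntries, hl, hB, hd, map_entryCode_eqPair, h₀.reg25, h₀.reg7, hi.reg9, hi.reg10,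
        signCode] using hs
    · refine (emitPair_triple (by simp) (by simp) (by simp) (by simp) (by simp) (by simp) s₀
        _).mono (fun _ h => h) (by omega) fun s hs => ?_
      simpa [headEntries, hl, hB, hB', map_entryCode_eqPair, h₀.reg25, h₀.reg7, h₀.reg18 l hl,
        hi.reg9, hi.reg10, signCode] using hs

theorem edgeTail_triple (h : C.IsLead lead) {e : Fin m} {s₀ : RamMem} (h₀ : C.EdgeMem lead e s₀)
    (L : List (ℕ × ℕ × ℕ)) :
    RamTriple (Extends 7 6 s₀ L) edgeTail 13
      (Extends 7 6 s₀ (L ++ (tailEntries C lead e).map (entryCode (rowEquiv k m)))) := by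
  have hi := h₀.input
  -- The kinds above `3` are those of ∧ and ∨, the gates that have a leading edge.
  refine RamTriple.ite (B := ∃ l, lead (C.src e) = some l) (c := 12) (fun s hs => ?_)
    (fun hB => ?_) fun hB => ?_
  · rw [RamTest.Holds, reg_eq_of_extends hs (by simp), reg_eq_of_extends hs (by simp), h₀.reg17,
      hi.reg12]
    by_cases hl : (C.label (C.src e)).IsLeaf
    · rw [h.eq_none hl]
      rcases hlab : C.label (C.src e) with (_ | _) | ⟨v, (_ | _)⟩ | _ | _ <;>
        simp_all [GateLabel.kind, GateLabel.IsLeaf]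
    · obtain ⟨e', he'⟩ := C.exists_dst_eq hl
      obtain ⟨l, hl'⟩ := h.exists_eq e'
      rw [← he', hl']
      rcases C.label_dst e' with hd | hd <;> simp [hd, GateLabel.kind]
  · obtain ⟨l, hl⟩ := hB
    refine (emitPair_triple (by simp) (by simp) (by simp) (by simp) (by simp) (by simp) s₀ L).mono
      (fun _ h => h) (by omega) fun s hs => ?_
    simpa [tailEntries, hl, map_entryCode_eqPair, h₀.reg22 l hl, h₀.reg7, hi.reg9, hi.reg10,
      signCode] using hs
  · have hl : lead (C.src e) = none := by
      cases hl : lead (C.src e) with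
      | none => rfl
      | some l => exact absurd ⟨l, hl⟩ hB
    have hleaf := h.isLeaf_of_none hl
    refine RamTriple.ite (B := ∃ v, C.label (C.src e) = .lit v true) (c := 11) (fun s hs => ?_)
      (fun hB => ?_) fun hB => ?_
    · rw [RamTest.Holds, reg_eq_of_extends hs (by simp), reg_eq_of_extends hs (by simp), h₀.reg17,
        hi.reg12]
      rcases hlab : C.label (C.src e) with (_ | _) | ⟨v, (_ | _)⟩ | _ | _ <;>
        simp_all [GateLabel.kind, GateLabel.IsLeaf]
    · obtain ⟨v, hv⟩ := hB
      refine (emitPair_triple (by simp) (by simp) (by simp) (by simp) (by simp) (by simp) s₀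
        L).mono (fun _ h => h) (by omega) fun s hs => ?_
      simpa [tailEntries, hl, hv, map_entryCode_varPair, h₀.reg24 v true hv, h₀.reg7, hi.reg9,
        hi.reg10, signCode] using hs
    · refine RamTriple.ite (B := C.label (C.src e) = .const false) (c := 10) (fun s hs => ?_)
        (fun hB' => ?_) fun hB' => ?_
      · rw [RamTest.Holds, reg_eq_of_extends hs (by simp), reg_eq_of_extends hs (by simp), h₀.reg17,
          hi.reg13]
        rcases hlab : C.label (C.src e) with (_ | _) | ⟨v, (_ | _)⟩ | _ | _ <;>
          simp_all [GateLabel.kind, GateLabel.IsLeaf]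
      · refine (emit_triple (by simp) (by simp) (by simp) s₀ L).mono (fun _ h => h) (by omega)
          fun s hs => ?_
        simpa [tailEntries, hl, hB', entryCode, rowEquiv_edge, h₀.reg26, h₀.reg7, hi.reg9,
          signCode] using hs
      · refine (skip_triple _ (by omega)).mono (fun _ h => h) le_rfl fun s hs => ?_
        have : tailEntries C lead e = [] := by
          rcases hlab : C.label (C.src e) with (_ | _) | ⟨v, (_ | _)⟩ | _ | _ <;>
            simp_all [tailEntries]
        simpa [this] using hs

/-- The cost is 18 for the loads, 4 for the nonnegativity entry, 22 and 13 for the head and the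
tail, and 1 to advance. -/
theorem edgeStep_triple (h : C.IsLead lead) (j : ℕ) (hj : j < m) :
    RamTriple (C.EdgeInv lead j) edgeStep 58 (C.EdgeInv lead (j + 1)) := by
  intro s hs
  let s₀ := edgeLoads.run s
  have h₀ : C.EdgeMem lead ⟨j, hj⟩ s₀ := hs.edgeMem hj
  have hag0 := agree_edgeLoads s
  have t0 : RamTriple (· = s) edgeLoads 18
      (Extends 7 6 s₀ (codePrefix (edgeEntries C lead) j)) := by
    have hst : edgeLoads.IsStraight := by simp [edgeLoads, IsStraight]
    refine (hst.ramTriple ?_).mono (fun _ h => h) le_rfl fun _ h => h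
    rintro _ rfl
    exact ⟨Agree.refl _ _ _, hs.edgeList.congr (hag0.1 _ (by simp)) (hag0.2 _ (by simp))
      (hag0.2 _ (by simp)) (hag0.2 _ (by simp))⟩
  have t1 := emit_triple (a := 7) (c := 6) (r := 20) (q := 7) (v := 10) (by simp) (by simp)
    (by simp) s₀ (codePrefix (edgeEntries C lead) j)
  have t2 := edgeHead_triple h h₀ (codePrefix (edgeEntries C lead) j ++
    [(s₀.reg 20, s₀.reg 7, s₀.reg 10)])
  have t3 := edgeTail_triple h h₀ (codePrefix (edgeEntries C lead) j ++
    [(s₀.reg 20, s₀.reg 7, s₀.reg 10)] ++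
    (headEntries C lead ⟨j, hj⟩).map (entryCode (rowEquiv k m)))
  have hL : codePrefix (edgeEntries C lead) j ++ [(s₀.reg 20, s₀.reg 7, s₀.reg 10)] ++
      (headEntries C lead ⟨j, hj⟩).map (entryCode (rowEquiv k m)) ++
      (tailEntries C lead ⟨j, hj⟩).map (entryCode (rowEquiv k m))
      = codePrefix (edgeEntries C lead) (j + 1) := by
    rw [codePrefix_succ _ hj, h₀.reg20, h₀.reg7, h₀.input.reg10]
    simp [edgeEntries, entryCode, rowEquiv_edge, signCode]
  rw [hL] at t3
  have t4 : RamTriple (Extends 7 6 s₀ (codePrefix (edgeEntries C lead) (j + 1))) (.succ 7) 1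
      (C.EdgeInv lead (j + 1)) := by
    refine IsStraight.ramTriple (p := .succ 7) trivial fun s' hs' => ?_
    have hag : Agree [6, 7, 14, 15, 16, 17, 18, 19, 20, 21, 22, 23, 24, 25, 26] [7, 8, 9]
        ((RamProg.succ 7).run s') s := by
      refine Agree.trans (s' := s') ?_ ((hs'.1.mono (by simp) (by simp)).trans
        (hag0.mono (by simp) (by simp)))
      refine ⟨fun x hx => ?_, fun x hx => rfl⟩
      simp only [List.mem_cons, List.not_mem_nil, or_false, not_or] at hx
      simp [run, hx]
    refine ⟨hs.mem.congr hag (by simp) (by simp), (hag.1 4 (by simp)).trans hs.reg4, ?_, ?_, ?_, ?_⟩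
    · have : s'.reg 7 = j := (reg_eq_of_extends hs' (by simp)).trans h₀.reg7
      simp [run, this]
    · rw [hag.2 12 (by simp)]
      exact hs.row
    · exact hs.varList.congr (hag.1 _ (by simp)) (hag.2 _ (by simp)) (hag.2 _ (by simp))
        (hag.2 _ (by simp))
    · exact hs'.2.congr (by simp [run]) rfl rfl rfl
  exact (t0.seq (t1.seq (t2.seq (t3.seq t4)))) s rfl

theorem edgeLoop_triple (h : C.IsLead lead) :
    RamTriple (C.EdgeInv lead 0) (.loop (.lt 7 2) edgeStep) (m * 59 + 1) (C.EdgeInv lead m) := by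
  refine RamTriple.loop (c := 58) (fun j s hs => ?_) (edgeStep_triple h)
  rw [RamTest.Holds, hs.reg7, hs.mem.input.reg2]

end NNF

/-! ### Right hand side, total running time and number of variables -/

namespace NNF

open RamMem RamProg

variable {k n m : ℕ} {C : NNF (Fin k) (Fin n) (Fin m)} {lead : Fin n → Option (Fin m)}

/-- The array `10` contains the right hand side. -/
def HoldsRhs (C : NNF (Fin k) (Fin n) (Fin m)) (lead : Fin n → Option (Fin m)) (a : ℕ → ℕ) : Prop :=
  ∀ r, a (rowEquiv k m r) ≤ 2 ∧ sysRhs C lead r = decodeCoeff (a (rowEquiv k m r))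

/-- Only the unit that leaves the output makes the right hand side nonzero; here it enters the two
opposite rows of the leading edge of the output. -/
theorem IsLead.holdsRhs_some (h : C.IsLead lead) {l : Fin m} (hl : lead C.out = some l) :
    HoldsRhs C lead (Function.update (Function.update (fun _ => 0) (4 * (l : ℕ) + 1) 1)
      (4 * (l : ℕ) + 1 + 1) 2) := by
  have hlab : ¬ (C.label C.out).IsLeaf := fun hc => by
    rw [h.eq_none hc] at hl
    cases hl
  have h1 : ∀ v, C.label C.out ≠ .lit v true := fun v hv => hlab (hv ▸ trivial)
  have h2 : C.label C.out ≠ .const false := fun hv => hlab (hv ▸ trivial)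
  have hlm := l.2
  unfold HoldsRhs
  rw [forall_sysRow]
  refine ⟨fun e => ⟨?_, ?_, ?_, ?_⟩, fun v => ⟨?_, ?_⟩, ?_⟩
  · rw [rowEquiv_edge, Function.update_of_ne (by simp; omega), Function.update_of_ne (by simp; omega)]
    simp [sysRhs, decodeCoeff]
  · rw [rowEquiv_edge, Function.update_of_ne (by simp; omega)]
    by_cases he : l = e
    · simp [sysRhs, decodeCoeff, hl, he]
    · have : (e : ℕ) ≠ l := fun hh => he (Fin.ext hh.symm)
      rw [Function.update_of_ne (by simpa using this)]
      simp [sysRhs, decodeCoeff, hl, he]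
  · rw [rowEquiv_edge]
    by_cases he : l = e
    · simp [sysRhs, decodeCoeff, hl, he]
    · have : (e : ℕ) ≠ l := fun hh => he (Fin.ext hh.symm)
      rw [Function.update_of_ne (by simp; omega), Function.update_of_ne (by simp; omega)]
      simp [sysRhs, decodeCoeff, hl, he]
  · rw [rowEquiv_edge, Function.update_of_ne (by simp; omega), Function.update_of_ne (by simp; omega)]
    simp [sysRhs, decodeCoeff]
  · rw [rowEquiv_var, Function.update_of_ne (by simp; omega), Function.update_of_ne (by simp; omega)]
    simp [sysRhs, decodeCoeff, h1]
  · rw [rowEquiv_var, Function.update_of_ne (by simp; omega), Function.update_of_ne (by simp; omega)]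
    simp [sysRhs, decodeCoeff, h1]
  · rw [rowEquiv_out, Function.update_of_ne (by omega), Function.update_of_ne (by omega)]
    simp [sysRhs, decodeCoeff, h2]

theorem IsLead.holdsRhs_lit (h : C.IsLead lead) {v : Fin k} (hv : C.label C.out = .lit v true) :
    HoldsRhs C lead (Function.update (Function.update (fun _ => 0) (4 * m + 2 * (v : ℕ)) 1)
      (4 * m + 2 * (v : ℕ) + 1) 2) := by
  have hl : lead C.out = none := h.eq_none (hv ▸ trivial)
  have hvk := v.2
  unfold HoldsRhs
  rw [forall_sysRow]
  refine ⟨fun e => ⟨?_, ?_, ?_, ?_⟩, fun w => ⟨?_, ?_⟩, ?_⟩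
  iterate 4
    have he := e.2
    rw [rowEquiv_edge, Function.update_of_ne (by simp; omega), Function.update_of_ne (by simp; omega)]
    simp [sysRhs, decodeCoeff, hl]
  · rw [rowEquiv_var, Function.update_of_ne (by simp; omega)]
    by_cases he : v = w
    · simp [sysRhs, decodeCoeff, hv, he]
    · have : (w : ℕ) ≠ v := fun hh => he (Fin.ext hh.symm)
      rw [Function.update_of_ne (by simpa using this)]
      simp [sysRhs, decodeCoeff, hv, he]
  · rw [rowEquiv_var]
    by_cases he : v = w
    · simp [sysRhs, decodeCoeff, hv, he]
    · have : (w : ℕ) ≠ v := fun hh => he (Fin.ext hh.symm)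
      rw [Function.update_of_ne (by simp; omega), Function.update_of_ne (by simp; omega)]
      simp [sysRhs, decodeCoeff, hv, he]
  · rw [rowEquiv_out, Function.update_of_ne (by omega), Function.update_of_ne (by omega)]
    simp [sysRhs, decodeCoeff, hv]

theorem IsLead.holdsRhs_zero (h : C.IsLead lead) (hf : C.label C.out = .const false) :
    HoldsRhs C lead (Function.update (fun _ => 0) (4 * m + 2 * k) 2) := by
  have hl : lead C.out = none := h.eq_none (hf ▸ trivial)
  unfold HoldsRhs
  rw [forall_sysRow]
  refine ⟨fun e => ⟨?_, ?_, ?_, ?_⟩, fun w => ⟨?_, ?_⟩, ?_⟩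
  iterate 4
    have he := e.2
    rw [rowEquiv_edge, Function.update_of_ne (by simp; omega)]
    simp [sysRhs, decodeCoeff, hl]
  iterate 2
    have hw := w.2
    rw [rowEquiv_var, Function.update_of_ne (by simp; omega)]
    simp [sysRhs, decodeCoeff, hf]
  · rw [rowEquiv_out]
    simp [sysRhs, decodeCoeff, hf]

theorem holdsRhs_const (hl : lead C.out = none) (h1 : ∀ v, C.label C.out ≠ .lit v true)
    (h2 : C.label C.out ≠ .const false) : HoldsRhs C lead (fun _ => 0) := by
  unfold HoldsRhs
  rw [forall_sysRow]
  simp [sysRhs, decodeCoeff, hl, h1, h2]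

/-- The memory in which the right hand side is written. -/
structure RhsMem (C : NNF (Fin k) (Fin n) (Fin m)) (lead : Fin n → Option (Fin m))
    (s : RamMem) : Prop where
  inv : C.EdgeInv lead m s
  reg14 : s.reg 14 = (C.label C.out).kind
  reg16 : ∀ l, lead C.out = some l → s.reg 16 = 4 * l
  reg18 : ∀ v b, C.label C.out = .lit v b → s.reg 18 = 4 * m + 2 * v

/-- The memory at the end. -/
structure FinalMem (C : NNF (Fin k) (Fin n) (Fin m)) (lead : Fin n → Option (Fin m)) (r : ℕ)
    (s : RamMem) : Prop where
  reg4 : s.reg 4 = r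
  varList : HoldsList 4 5 ((varList k m).map (entryCode (rowEquiv k m))) s
  edgeList : HoldsList 7 6 ((edgeList C lead).map (entryCode (rowEquiv k m))) s
  rhs : HoldsRhs C lead (s.arr 10)

theorem RhsMem.finalMem {s s' : RamMem} (h : C.RhsMem lead s) (hs : Agree [16, 18] [10] s' s)
    (hr : HoldsRhs C lead (s'.arr 10)) : C.FinalMem lead (4 * m + 2 * k) s' where
  reg4 := (hs.1 4 (by simp)).trans h.inv.reg4
  varList := h.inv.varList.congr (hs.1 _ (by simp)) (hs.2 _ (by simp)) (hs.2 _ (by simp))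
    (hs.2 _ (by simp))
  edgeList := by
    have := h.inv.edgeList
    rw [codePrefix_self] at this
    exact this.congr (hs.1 _ (by simp)) (hs.2 _ (by simp)) (hs.2 _ (by simp)) (hs.2 _ (by simp))
  rhs := hr

theorem rhsLoads_triple :
    RamTriple (C.EdgeInv lead m)
      (.seq (.load 14 0 3) (.seq (.load 15 13 3) (.seq (.load 16 11 15) (.seq (.load 17 1 3)
        (.load 18 12 17))))) 5 (C.RhsMem lead) := by
  refine (IsStraight.ramTriple (by simp [IsStraight]) fun s hs => ?_).mono (fun _ h => h) le_rfl
    fun _ h => h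
  have hi := hs.mem.input
  refine ⟨⟨?_, ?_, ?_, ?_, ?_, ?_⟩, ?_, fun l hl => ?_, fun v b hv => ?_⟩
  · refine hs.mem.congr (X := [14, 15, 16, 17, 18]) (Y := []) ⟨fun x hx => ?_, fun x _ => ?_⟩
      (by simp) (by simp)
    · simp only [List.mem_cons, List.not_mem_nil, or_false, not_or] at hx
      simp [run, hx]
    · simp [run]
  · simp [run, hs.reg4]
  · simp [run, hs.reg7]
  · simpa [run] using hs.row
  · exact hs.varList.congr (by simp [run]) rfl rfl rfl
  · exact hs.edgeList.congr (by simp [run]) rfl rfl rfl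
  · simp [run, hi.reg3, hi.kind]
  · simp [run, hi.reg3, hs.mem.lead _ _ hl, hs.mem.row]
  · simp [run, hi.reg3, hi.varIdx, hv, GateLabel.varIdx, hs.row]

theorem writeRhs_triple (h : C.IsLead lead) :
    RamTriple (C.EdgeInv lead m) writeRhs 13 (C.FinalMem lead (m * 4 + (k * 2 + 1))) := by
  have t1 : RamTriple (C.RhsMem lead)
      (.ite (.lt 12 14) (.seq (.succ 16) (.seq (.store 10 16 9) (.seq (.succ 16) (.store 10 16 10))))
      (.ite (.eq 14 12) (.seq (.store 10 18 9) (.seq (.succ 18) (.store 10 18 10)))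
        (.ite (.eq 14 13) (.store 10 4 10) .skip))) 7 (C.FinalMem lead (4 * m + 2 * k)) := by
    have hrhs : ∀ s, C.RhsMem lead s → s.arr 10 = fun _ => 0 := fun s hs =>
      funext hs.inv.mem.input.rhs
    refine RamTriple.ite (B := ∃ l, lead C.out = some l) (c := 6) (fun s hs => ?_) (fun hB => ?_)
      fun hB => ?_
    · rw [RamTest.Holds, hs.reg14, hs.inv.mem.input.reg12]
      by_cases hl : (C.label C.out).IsLeaf
      · rw [h.eq_none hl]
        rcases hlab : C.label C.out with (_ | _) | ⟨v, (_ | _)⟩ | _ | _ <;>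
          simp_all [GateLabel.kind, GateLabel.IsLeaf]
      · obtain ⟨e', he'⟩ := C.exists_dst_eq hl
        obtain ⟨l, hl'⟩ := h.exists_eq e'
        rw [← he', hl']
        rcases C.label_dst e' with hd | hd <;> simp [hd, GateLabel.kind]
    · obtain ⟨l, hl⟩ := hB
      refine (IsStraight.ramTriple (by simp [IsStraight]) fun s hs => ?_).mono (fun _ h => h)
        (by simp [cost]) fun _ h => h
      refine hs.finalMem ⟨fun x hx => ?_, fun x hx => ?_⟩ ?_
      · simp only [List.mem_cons, List.not_mem_nil, or_false, not_or] at hx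
        simp [run, hx]
      · simp only [List.mem_cons, List.not_mem_nil, or_false] at hx
        simp [run, hx]
      · simpa [run, hrhs s hs, hs.reg16 l hl, hs.inv.mem.input.reg9, hs.inv.mem.input.reg10]
          using h.holdsRhs_some hl
    · have hl : lead C.out = none := by
        cases hl : lead C.out with
        | none => rfl
        | some l => exact absurd ⟨l, hl⟩ hB
      have hleaf := h.isLeaf_of_none hl
      refine RamTriple.ite (B := ∃ v, C.label C.out = .lit v true) (c := 5) (fun s hs => ?_)
        (fun hB => ?_) fun hB => ?_
      · rw [RamTest.Holds, hs.reg14, hs.inv.mem.input.reg12]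
        rcases hlab : C.label C.out with (_ | _) | ⟨v, (_ | _)⟩ | _ | _ <;>
          simp_all [GateLabel.kind, GateLabel.IsLeaf]
      · obtain ⟨v, hv⟩ := hB
        refine (IsStraight.ramTriple (by simp [IsStraight]) fun s hs => ?_).mono (fun _ h => h)
          (by simp [cost]) fun _ h => h
        refine hs.finalMem ⟨fun x hx => ?_, fun x hx => ?_⟩ ?_
        · simp only [List.mem_cons, List.not_mem_nil, or_false, not_or] at hx
          simp [run, hx]
        · simp only [List.mem_cons, List.not_mem_nil, or_false] at hx
          simp [run, hx]
        · simpa [run, hrhs s hs, hs.reg18 v true hv, hs.inv.mem.input.reg9,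
            hs.inv.mem.input.reg10] using h.holdsRhs_lit hv
      · refine RamTriple.ite (B := C.label C.out = .const false) (c := 4) (fun s hs => ?_)
          (fun hB' => ?_) fun hB' => ?_
        · rw [RamTest.Holds, hs.reg14, hs.inv.mem.input.reg13]
          rcases hlab : C.label C.out with (_ | _) | ⟨v, (_ | _)⟩ | _ | _ <;>
            simp_all [GateLabel.kind, GateLabel.IsLeaf]
        · refine (IsStraight.ramTriple (by simp [IsStraight]) fun s hs => ?_).mono (fun _ h => h)
            (by simp [cost]) fun _ h => h
          refine hs.finalMem ⟨fun x hx => ?_, fun x hx => ?_⟩ ?_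
          · simp [run]
          · simp only [List.mem_cons, List.not_mem_nil, or_false] at hx
            simp [run, hx]
          · simpa [run, hrhs s hs, hs.inv.reg4, hs.inv.mem.input.reg10] using h.holdsRhs_zero hB'
        · refine (skip_triple _ (by omega)).mono (fun _ h => h) le_rfl fun s hs => ?_
          refine hs.finalMem (Agree.refl _ _ _) ?_
          rw [hrhs s hs]
          exact holdsRhs_const hl (fun v hv => hB ⟨v, hv⟩) hB'
  -- Register `4` has so far held the number of the last row, counted from zero; one more is the
  -- number of rows.
  have t2 : RamTriple (C.FinalMem lead (4 * m + 2 * k)) (.succ 4) 1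
      (C.FinalMem lead (m * 4 + (k * 2 + 1))) := by
    refine IsStraight.ramTriple (p := .succ 4) trivial fun s hs => ⟨?_, ?_, ?_, hs.rhs⟩
    · simp [run, hs.reg4]
      ring
    · exact hs.varList.congr (by simp [run]) rfl rfl rfl
    · exact hs.edgeList.congr (by simp [run]) rfl rfl rfl
  exact rhsLoads_triple.seq (t1.seq t2)

theorem varInv_zero_of_leadInv {s : RamMem} (hs : C.LeadInv m s) (h : C.LeadMem lead s) :
    C.VarInv lead 0 (s.setReg 7 0) := by
  refine ⟨h.congr (X := [7]) (Y := []) ⟨fun x hx => ?_, fun x _ => rfl⟩ (by simp) (by simp),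
    ?_, ?_, ?_, ?_, ?_, ?_⟩
  · simp only [List.mem_cons, List.not_mem_nil, or_false] at hx
    simp [hx]
  · simp [hs.reg6]
  · simp [hs.reg4]
  · simp
  · simp
  · simp [hs.reg5, codePrefix]
  · simp [codePrefix]

theorem VarInv.edgeInv_zero {s : RamMem} (hs : C.VarInv lead k s) :
    C.EdgeInv lead 0 (s.setReg 7 0) := by
  have hl := hs.list
  rw [codePrefix_self] at hl
  refine ⟨hs.mem.congr (X := [7]) (Y := []) ⟨fun x hx => ?_, fun x _ => rfl⟩ (by simp) (by simp),
    ?_, ?_, fun v => hs.row v v.2, hl.congr (by simp) rfl rfl rfl, ?_, ?_⟩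
  · simp only [List.mem_cons, List.not_mem_nil, or_false] at hx
    simp [hx]
  · simp [hs.reg4]
  · simp
  · simp [hs.reg6, codePrefix]
  · simp [codePrefix]

/-- The program writes the system for some choice of leading edges. -/
theorem exists_ramExec_systemProg (C : NNF (Fin k) (Fin n) (Fin m)) :
    ∃ lead, C.IsLead lead ∧ ∃ s t, RamExec systemProg C.encode s t ∧
      t ≤ 68 * m + 15 * k + 22 ∧ C.FinalMem lead (m * 4 + (k * 2 + 1)) s := by
  obtain ⟨s₁, t₁, he₁, ht₁, hs₁⟩ := initConstants_triple (C := C) C.encode rfl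
  obtain ⟨s₂, t₂, he₂, ht₂, hs₂⟩ := leadLoop_triple s₁ hs₁
  -- The run itself fixes the leading edges, and with them the matrix.
  obtain ⟨lead, hlead, hmem⟩ := hs₂.exists_lead
  obtain ⟨s₃, t₃, he₃, ht₃, hs₃⟩ := varLoop_triple _ (varInv_zero_of_leadInv hs₂ hmem)
  obtain ⟨s₄, t₄, he₄, ht₄, hs₄⟩ := edgeLoop_triple hlead _ hs₃.edgeInv_zero
  obtain ⟨s₅, t₅, he₅, ht₅, hs₅⟩ := writeRhs_triple hlead _ hs₄
  -- The time adds up as `4 + (9m + 1) + 1 + (15k + 1) + 1 + (59m + 1) + 13`.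
  exact ⟨lead, hlead, s₅, _, .seq he₁ (.seq he₂ (.seq (.const 7 0 _) (.seq he₃
    (.seq (.const 7 0 _) (.seq he₄ he₅))))), by omega, hs₅⟩

theorem isSparseList_of_holdsList {r c a q : ℕ} {R : Type*} (ρ : R ≃ Fin r)
    {L : List (R × Fin c × Bool)} (hL : (L.map fun p => (p.1, p.2.1)).Nodup) {s : RamMem}
    (h : HoldsList a q (L.map (entryCode ρ)) s) :
    IsSparseList (fun i j => entryMatrix L (ρ.symm i) j) (s.reg q) (s.arr a) (s.arr (a + 1))
      (s.arr (a + 2)) := by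
  rw [h.1, List.length_map]
  refine isSparseList_entryMatrix ρ hL fun t ht => ?_
  rw [h.2 t (by simpa using ht), List.getElem_map]

/-- Each variable has a literal gate that is the output or the tail of an edge, and a gate has only
one label. This makes bounds involving `k` linear in the number of edges. -/
theorem card_vars_le (C : NNF (Fin k) (Fin n) (Fin m)) (hv : C.vars C.out = Set.univ) :
    k ≤ m + 1 := by
  classical
  have hex : ∀ v : Fin k, ∃ o : Option (Fin m), ∃ g b, C.label g = .lit v b ∧
      g = o.elim C.out C.src := by
    intro v
    have : v ∈ C.vars C.out := hv ▸ trivial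
    obtain ⟨g, b, hl, hr⟩ := this
    rcases Relation.ReflTransGen.cases_head hr with rfl | ⟨a, ⟨e, rfl, -⟩, -⟩
    · exact ⟨none, _, b, hl, rfl⟩
    · exact ⟨some e, _, b, hl, rfl⟩
  choose o g b hl hg using hex
  have hinj : Function.Injective o := by
    intro v w hvw
    have h1 := hl v
    rw [hg v, hvw, ← hg w, hl w] at h1
    cases h1
    rfl
  simpa using Fintype.card_le_of_injective o hinj

end NNF

theorem mainTheorem4 :
    ∃ (K : ℕ) (P : RamProg), ∀ (k n m : ℕ) (C : NNF (Fin k) (Fin n) (Fin m)),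
      C.IsDecomposable → C.IsSmooth → C.vars C.out = Set.univ →
      ∃ (r : ℕ) (A : Matrix (Fin r) (Fin k) ℝ) (B : Matrix (Fin r) (Fin m) ℝ) (b : Fin r → ℝ),
        -- the projection of the polyhedron is the convex hull of the circuit
        C.conv = {x | ∃ y : Fin m → ℝ, A *ᵥ x + B *ᵥ y ≤ b} ∧
        -- the number of rows and the coefficients
        r ≤ K * max 1 m ∧
        (∀ i j, A i j ∈ ({-1, 0, 1} : Set ℝ)) ∧
        (∀ i j, B i j ∈ ({-1, 0, 1} : Set ℝ)) ∧
        (∀ i, b i ∈ ({-1, 0, 1} : Set ℝ)) ∧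
        -- the system is the flow system of the circuit
        (∀ x y, A *ᵥ x + B *ᵥ y ≤ b ↔ C.IsFlow x y) ∧
        -- its integer points correspond to the certificates of the circuit
        (C.IsConstantFree →
          Set.BijOn (fun p : Set (Fin n) × Set (Fin m) => (C.certX p.1, NNF.incidence p.2))
            {p | C.IsCertificate p.1 p.2} (integerPoints A B b)) ∧
        (C.IsConstantFree → C.HasNoNestedInputs →
          Set.BijOn (fun T => (C.certX T, NNF.incidence (C.induced T)))
            {T | C.IsGateCertificate T} (integerPoints A B b)) ∧
        -- a sparse representation is computed in linear time
        ∃ (s : RamMem) (t : ℕ), RamExec P C.encode s t ∧ t ≤ K * max 1 m ∧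
          s.HoldsSystem A B b := by
  -- With `k ≤ m + 1` the time bound `68m + 15k + 22` is at most `83m + 37`, and `83 + 37 = 120`.
  -- The `4m + 2k + 1` rows need much less.
  refine ⟨120, RamProg.systemProg, fun k n m C hC hS hv => ?_⟩
  obtain ⟨lead, hlead, s, t, hexec, ht, hs⟩ := C.exists_ramExec_systemProg
  have hk := C.card_vars_le hv
  have hmax : 1 ≤ max 1 m ∧ m ≤ max 1 m := ⟨le_max_left _ _, le_max_right _ _⟩
  let ρ := NNF.rowEquiv k m
  let A : Matrix (Fin (m * 4 + (k * 2 + 1))) (Fin k) ℝ :=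
    fun i j => entryMatrix (NNF.varList k m) (ρ.symm i) j
  let B : Matrix (Fin (m * 4 + (k * 2 + 1))) (Fin m) ℝ :=
    fun i j => entryMatrix (C.edgeList lead) (ρ.symm i) j
  let b : Fin (m * 4 + (k * 2 + 1)) → ℝ := fun i => C.sysRhs lead (ρ.symm i)
  have hflow : ∀ x y, A *ᵥ x + B *ᵥ y ≤ b ↔ C.IsFlow x y := by
    intro x y
    rw [← hlead.forall_rowForm_le_iff x y, Pi.le_def, ← ρ.symm.forall_congr_right]
    refine forall_congr' fun i => ?_
    rw [← sum_entryMatrix_mul NNF.nodup_varList, ← sum_entryMatrix_mul hlead.nodup_edgeList]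
    rfl
  have hint : integerPoints A B b
      = {p : (Fin k → ℝ) × (Fin m → ℝ) |
        C.IsFlow p.1 p.2 ∧ (∀ v, ∃ z : ℤ, p.1 v = z) ∧ ∀ e, ∃ z : ℤ, p.2 e = z} := by
    ext p
    exact and_congr_left' (hflow p.1 p.2)
  refine ⟨_, A, B, b, ?_, by omega, fun i j => entryMatrix_mem _ _ _,
    fun i j => entryMatrix_mem _ _ _, fun i => ?_, hflow, fun hC' => ?_, fun hC' hN => ?_,
    s, t, hexec, by omega, hs.reg4, NNF.isSparseList_of_holdsList ρ NNF.nodup_varList hs.varList,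
    NNF.isSparseList_of_holdsList ρ hlead.nodup_edgeList hs.edgeList, fun i => ?_⟩
  · simp only [hflow]
    exact NNF.conv_eq_setOf_isFlow hC hS hv
  · have hi := hs.rhs (ρ.symm i)
    have h2 := hi.1
    change C.sysRhs lead (ρ.symm i) ∈ _
    rw [hi.2]
    interval_cases s.arr 10 (NNF.rowEquiv k m (ρ.symm i)) <;> simp [decodeCoeff]
  · rw [hint]
    exact NNF.bijOn_certificates hC hC'
  · rw [hint]
    exact NNF.bijOn_gateCertificates hC hS hC' hN
  · have hi := hs.rhs (ρ.symm i)
    change _ ∧ C.sysRhs lead (ρ.symm i) = _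
    rwa [show NNF.rowEquiv k m (ρ.symm i) = i from ρ.apply_symm_apply i] at hi
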